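/- Time is discrete, $t\in\{0,1,2,\dots\}$. Let $E,E'$ be finite sets. A Markov additive process with kernel $F=(F_{ij}(dx))_{i,j\in E}$ is a process $(J_t,M(t))$, $J_t\in E$, $M(0)=0$, such that, conditionally on $(J_s,M(s))_{s\le t}$, the pair $(J_{t+1},M(t+1)-M(t))$ has law $F_{J_t j}(dx)$; here the $F_{ij}$ are finite measures on $\mathbb R$ with $\sum_jF_{ij}(\mathbb R)=1$, and the transition matrix $(F_{ij}(\mathbb R))_{i,j}$ is assumed irreducible. For $\theta$ with all $\int e^{\theta x}F_{ij}(dx)$ finite, let $e^{\kappa(\theta)}$ be the Perron–Frobenius eigenvalue (the eigenvalue of maximal absolute value) of the matrix $\widehat F[\theta]=\big(\int e^{\theta x}F_{ij}(dx)\big)_{i,j}$ and let $h(\theta)=(h_i(\theta))_i$ be a corresponding positive right eigenvector. Let $A(t)$ (arrivals, with state process $J^A_t\in E$ and nonnegative increments) and $S(t)$ (capacity, with state process $J^S_t\in E'$) be independent Markov additive processes with arbitrary initial distributions. Write $\kappa^A,h^A$ for the quantities above belonging to $A$, and $\kappa^{-S},h^{-S}$ for those belonging to $-S$ (with state process $J^{-S}=J^S$),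 and let $\Theta$ be the interior of the set of $\theta$ for which both $\widehat F^A[\theta]$ and $\widehat F^{-S}[\theta]$ are finite. Write $A(s,t)=A(t)-A(s)$ and $S(s,t)=S(t)-S(s)$. The delay and backlog events are understood in their time-reversed form: for an integer $d\ge0$ and a real $b\ge 0$, $$\{D>d\}=\Big\{\sup_{t\ge d}\big(A(d,t)-S(0,t)\big)>0\Big\},\qquad \{D(t)>d;\,t\le T\}=\{\exists\, t,\ d\le t\le T:\ A(d,t)-S(0,t)>0\},$$ $$\{B>b\}=\Big\{\sup_{t\ge 0}\big(A(t)-S(t)\big)>b\Big\},\qquad \{B(t)>b;\,t\le T\}=\{\exists\, t,\ 0\le t\le T:\ A(t)-S(t)>b\}.$$ For the delay, $\mathbb P_{\boldsymbol i}$ denotes the conditional probability given $J^A_d=i^A,\ J^{-S}_0=i^{-S}$; for the backlog, given $J^A_0=i^A,\ J^{-S}_0=i^{-S}$. Let $\gamma>0$, $\gamma\in\Theta$, satisfy $\kappa^A(\gamma)+\kappa^{-S}(\gamma)=0$ and $\dot\kappa^A(\gamma)+\dot\kappa^{-S}(\gamma)>0$. **Delay.** Put $y_\gamma=\dfrac{\dot\kappa^A(\gamma)}{\dot\kappa^A(\gamma)+\dot\kappa^{-S}(\gamma)}$.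 Let $y>1$, let $\theta\in\Theta$ be a root of $y\,\dot\kappa^{-S}(\theta)=-(y-1)\,\dot\kappa^A(\theta)$, and put $\theta_y=-y\,\kappa^{-S}(\theta)-(y-1)\,\kappa^A(\theta)$. Then for every integer $d\ge 0$ and all $i^A\in E$, $i^{-S}\in E'$, $$\mathbb P_{\boldsymbol i}(D(t)>d;\,t\le yd)\le H^D_+\,h^{-S}_{i^{-S}}(\theta)\,e^{-d\theta_y}\quad\text{if } y<y_\gamma,$$ $$\mathbb P_{\boldsymbol i}(D>d)-\mathbb P_{\boldsymbol i}(D(t)>d;\,t\le yd)\le H^D_+\,h^{-S}_{i^{-S}}(\theta)\,e^{-d\theta_y}\quad\text{if } y>y_\gamma,$$ where $H^D_+=\dfrac{\max_{j\in E}h^A_j(\theta)}{\min_{j\in E}h^A_j(\theta)}\cdot\dfrac1{\min_{j\in E'}h^{-S}_j(\theta)}$. **Backlog.** Put $y_\gamma=\dfrac{1}{\dot\kappa^A(\gamma)+\dot\kappa^{-S}(\gamma)}$. Let $y>0$, let $\theta\in\Theta$ be a root of $y\big(\dot\kappa^A(\theta)+\dot\kappa^{-S}(\theta)\big)=1$,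 and put $\theta_y=\theta-y\big(\kappa^A(\theta)+\kappa^{-S}(\theta)\big)$. Then for every real $b\ge0$ and all $i^A\in E$, $i^{-S}\in E'$, $$\mathbb P_{\boldsymbol i}(B(t)>b;\,t\le yb)\le H^B_+\,h^A_{i^A}(\theta)\,h^{-S}_{i^{-S}}(\theta)\,e^{-b\theta_y}\quad\text{if } y<y_\gamma,$$ $$\mathbb P_{\boldsymbol i}(B>b)-\mathbb P_{\boldsymbol i}(B(t)>b;\,t\le yb)\le H^B_+\,h^A_{i^A}(\theta)\,h^{-S}_{i^{-S}}(\theta)\,e^{-b\theta_y}\quad\text{if } y>y_\gamma,$$ where $H^B_+=\dfrac1{\min_{j\in E}h^A_j(\theta)}\cdot\dfrac1{\min_{j\in E'}h^{-S}_j(\theta)}$. -/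

import Mathlib

namespace MarkovAdditive

open MeasureTheory ProbabilityTheory

/-! ### Measure-valued kernels of discrete-time Markov additive processes -/

section Kernel

variable {E : Type*} [Fintype E]

/-- A measure-valued matrix `F i j (dx)` of defective probability distributions on `ℝ` whose rows
have total mass one: `F i j (dx) = P_{i,0}(J_1 = j, Y_1 ∈ dx)`. -/
def IsKernel (F : E → E → Measure ℝ) : Prop :=
  ∀ i, ∑ j, F i j Set.univ = 1

/-- The transition matrix `p i j = P_i(J_1 = j)` of the underlying Markov chain. -/
noncomputable def transitionMatrix (F : E → E → Measure ℝ) : Matrix E E ℝ :=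
  fun i j => (F i j).real Set.univ

/-- The kernel of the process `-S` when `F` is the kernel of `S`. -/
noncomputable def negKernel (F : E → E → Measure ℝ) : E → E → Measure ℝ :=
  fun i j => (F i j).map (fun x => -x)

/-- The set of all `θ` for which every `∫ e^{θ x} F i j (dx)` is finite. -/
def expDomain (F : E → E → Measure ℝ) : Set ℝ :=
  {θ | ∀ i j, Integrable (fun x : ℝ => Real.exp (θ * x)) (F i j)}

/-- The matrix with entries `∫ e^{θ x} F i j (dx)`. -/
noncomputable def expMatrix (F : E → E → Measure ℝ) (θ : ℝ) : Matrix E E ℝ :=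
  fun i j => ∫ x, Real.exp (θ * x) ∂(F i j)

/-- `κ(θ)`: the logarithm of the Perron-Frobenius eigenvalue of `expMatrix F θ`, the maximal
absolute value of its (complex) eigenvalues. -/
noncomputable def kappa [DecidableEq E] (F : E → E → Measure ℝ) (θ : ℝ) : ℝ :=
  Real.log (spectralRadius ℂ ((expMatrix F θ).map (fun x : ℝ => (x : ℂ)))).toReal

/-- `h` is a right Perron-Frobenius eigenvector of `expMatrix F θ`: it is positive and belongs to
the eigenvalue `e^{κ(θ)}`. No normalization is imposed. -/
def IsPerronVector [DecidableEq E] (F : E → E → Measure ℝ) (θ : ℝ) (h : E → ℝ) : Prop :=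
  (∀ i, 0 < h i) ∧ (expMatrix F θ).mulVec h = Real.exp (kappa F θ) • h

end Kernel

/-! ### Markov additive processes -/

section Additive

variable {Ω E : Type*} [MeasurableSpace Ω] [MeasurableSpace E]

/-- The history `σ((J_0, S(0)), …, (J_t, S(t)))` of the bivariate process up to time `t`. -/
abbrev history (J : ℕ → Ω → E) (S : ℕ → Ω → ℝ) (t : ℕ) : MeasurableSpace Ω :=
  ⨆ s ∈ Set.Iic t, MeasurableSpace.comap (fun ω => (J s ω, S s ω)) inferInstance

/-- `(J, S)` is, under `μ`, a discrete-time Markov additive process with kernel `F`: given the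
history up to time `t`, the next increment of `S` and the next state have the joint law
`F (J_t) j (dx)`. The initial distribution is the law of `J 0`, which is arbitrary. -/
structure IsProcess [Fintype E] (μ : Measure Ω) (F : E → E → Measure ℝ)
    (J : ℕ → Ω → E) (S : ℕ → Ω → ℝ) : Prop where
  measurable_state : ∀ t, Measurable (J t)
  measurable_additive : ∀ t, Measurable (S t)
  start_zero : ∀ ω, S 0 ω = 0
  markov_additive : ∀ (t : ℕ) (f : ℝ → ℝ) (g : E → ℝ), Measurable f → (∃ C, ∀ x, |f x| ≤ C) →
    μ[fun ω => f (S (t + 1) ω - S t ω) * g (J (t + 1) ω) | history J S t] =ᵐ[μ]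
      fun ω => ∑ j, g j * ∫ x, f x ∂(F (J t ω) j)

end Additive

/-! ### The queue -/

section Queue

/-- `X(s,t) = X(t) - X(s)`, the cumulative amount of `X` in the time interval `(s,t]`. -/
def cumul (X : ℕ → ℝ) (s t : ℕ) : ℝ := X t - X s

/-- The backlog `B(t) = sup_{0 ≤ s ≤ t} (A(s,t) - S(s,t))`. -/
noncomputable def backlog (A S : ℕ → ℝ) (t : ℕ) : ℝ :=
  (Finset.range (t + 1)).sup' Finset.nonempty_range_add_one fun s => cumul A s t - cumul S s t

/-- The output `A*(t) = A(t) - B(t)`. -/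
noncomputable def output (A S : ℕ → ℝ) (t : ℕ) : ℝ := cumul A 0 t - backlog A S t

/-- The virtual delay `D(t) = inf {d ≥ 0 : A(t-d) ≤ A*(t)}`, where `A` vanishes before time `0`. -/
noncomputable def delay (A S : ℕ → ℝ) (t : ℕ) : ℕ :=
  sInf {d : ℕ | cumul A 0 (t - d) ≤ output A S t}

/-- The path whose increments over `(0,T]` are those of `X` in reversed order. -/
def reverse (X : ℕ → ℝ) (T : ℕ) : ℕ → ℝ := fun s => X T - X (T - s)

variable {Ω : Type*}

/-- The event `D > d` in its time-reversed form `sup_{t ≥ d} (A(d,t) - S(0,t)) > 0`. -/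
def delayExceeds (A S : ℕ → Ω → ℝ) (d : ℕ) : Set Ω :=
  {ω | ∃ t : ℕ, d ≤ t ∧ 0 < cumul (A · ω) d t - cumul (S · ω) 0 t}

/-- The event `D(t) > d; t ≤ T` in its time-reversed form: the first time `t ≥ d` with
`A(d,t) - S(0,t) > 0` is at most `T`. -/
def delayExceedsBy (A S : ℕ → Ω → ℝ) (d : ℕ) (T : ℝ) : Set Ω :=
  {ω | ∃ t : ℕ, d ≤ t ∧ (t : ℝ) ≤ T ∧ 0 < cumul (A · ω) d t - cumul (S · ω) 0 t}

/-- The event `B > b` in its time-reversed form `sup_{t ≥ 0} (A(t) - S(t)) > b`. -/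
def backlogExceeds (A S : ℕ → Ω → ℝ) (b : ℝ) : Set Ω :=
  {ω | ∃ t : ℕ, b < cumul (A · ω) 0 t - cumul (S · ω) 0 t}

/-- The event `B(t) > b; t ≤ T` in its time-reversed form: the first time `t` with
`A(t) - S(t) > b` is at most `T`. -/
def backlogExceedsBy (A S : ℕ → Ω → ℝ) (b : ℝ) (T : ℝ) : Set Ω :=
  {ω | ∃ t : ℕ, (t : ℝ) ≤ T ∧ b < cumul (A · ω) 0 t - cumul (S · ω) 0 t}

/-- Pathwise time reversal for the backlog: the queue fed with the reversed increments has
`B(T) > b` exactly if `A(t) - S(t) > b` for some `t ≤ T`. -/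
theorem lt_backlog_reverse_iff (A S : ℕ → ℝ) (T : ℕ) (b : ℝ) :
    b < backlog (reverse A T) (reverse S T) T ↔
      ∃ t ≤ T, b < cumul A 0 t - cumul S 0 t := by
  unfold backlog
  rw [Finset.lt_sup'_iff]
  constructor
  · rintro ⟨s, hs, h⟩
    refine ⟨T - s, Nat.sub_le _ _, ?_⟩
    simp only [cumul, reverse, Nat.sub_self] at h ⊢
    linarith
  · rintro ⟨t, ht, h⟩
    refine ⟨T - t, Finset.mem_range.2 (by omega), ?_⟩
    simp only [cumul, reverse, Nat.sub_self, Nat.sub_sub_self ht] at h ⊢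
    linarith

/-- Pathwise time reversal for the delay: for nondecreasing cumulative arrivals and capacity, the
queue fed with the reversed increments has `D(T) > d` exactly if `A(d,t) - S(0,t) > 0` for some
`t` with `d ≤ t ≤ T`. -/
theorem lt_delay_reverse_iff (A S : ℕ → ℝ) (hA : Monotone A) (hS : Monotone S) (T d : ℕ) :
    d < delay (reverse A T) (reverse S T) T ↔
      ∃ t, d ≤ t ∧ t ≤ T ∧ 0 < cumul A d t - cumul S 0 t := by
  have key : ∀ e : ℕ, ¬ (cumul (reverse A T) 0 (T - e) ≤ output (reverse A T) (reverse S T) T) ↔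
      ∃ t, e ≤ t ∧ t ≤ T ∧ 0 < cumul A e t - cumul S 0 t := by
    intro e
    rw [not_le]
    have h1 : output (reverse A T) (reverse S T) T < cumul (reverse A T) 0 (T - e) ↔
        A (min e T) - A 0 < backlog (reverse A T) (reverse S T) T := by
      have h2 : T - (T - e) = min e T := by omega
      simp only [output, cumul, reverse, Nat.sub_self, Nat.sub_zero, h2]
      constructor <;> intro h <;> linarith
    rw [h1, lt_backlog_reverse_iff]
    constructor
    · rintro ⟨t, ht, h⟩
      have h3 : S 0 ≤ S t := hS (Nat.zero_le t)
      simp only [cumul] at h ⊢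
      have h4 : min e T < t := by
        by_contra hc
        have := hA (not_lt.1 hc)
        linarith
      have h5 : min e T = e := by omega
      rw [h5] at h h4
      exact ⟨t, h4.le, ht, by linarith⟩
    · rintro ⟨t, het, ht, h⟩
      refine ⟨t, ht, ?_⟩
      have h5 : min e T = e := by omega
      simp only [cumul] at h ⊢
      rw [h5]
      linarith
  rw [← key d]
  unfold delay
  set D : Set ℕ :=
    {e : ℕ | cumul (reverse A T) 0 (T - e) ≤ output (reverse A T) (reverse S T) T} with hD
  have hne : D.Nonempty := by
    refine ⟨T + 1, ?_⟩
    by_contra hc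
    obtain ⟨t, h1, h2, -⟩ := (key (T + 1)).1 hc
    omega
  have hmono : ∀ e ∈ D, ∀ e', e ≤ e' → e' ∈ D := by
    intro e he e' hee
    by_contra hc
    obtain ⟨t, h1, h2, h3⟩ := (key e').1 hc
    refine (key e).2 ⟨t, hee.trans h1, h2, ?_⟩ he
    have := hA hee
    simp only [cumul] at h3 ⊢
    linarith
  constructor
  · intro h hd
    exact absurd (Nat.sInf_le (s := D) hd) (not_le.2 h)
  · intro h
    by_contra hc
    exact h (hmono _ (Nat.sInf_mem hne) d (not_lt.1 hc))

end Queue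

/-! ### Constants -/

/-- `H_+^D = (max h^A / min h^A) (1 / min h^{-S})`. -/
noncomputable def delayConst {E E' : Type*} (hA : E → ℝ) (hS : E' → ℝ) : ℝ :=
  (⨆ j, hA j) / (⨅ j, hA j) * (1 / ⨅ j, hS j)

/-- `H_+^B = (1 / min h^A) (1 / min h^{-S})`. -/
noncomputable def backlogConst {E E' : Type*} (hA : E → ℝ) (hS : E' → ℝ) : ℝ :=
  1 / (⨅ j, hA j) * (1 / ⨅ j, hS j)

end MarkovAdditive

open MeasureTheory ProbabilityTheory MarkovAdditive

/-! ### Perron-Frobenius theory of irreducible nonnegative matrices -/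

namespace Matrix

variable {n : Type*} [Fintype n]

/-! The engine is an exponential change of measure in its martingale form. For fixed `θ`, the
processes `exp(θ A(d,t) - (t-d) κA) hA(J^A_t)` and `exp(-θ S(0,t) - t κS) hS(J^S_t)` are nonnegative
martingales, and by independence so is their product from time `d` on. If `θ ≥ 0`, then on `A(d,t) -
S(0,t) > b` the product is at least `min hA * min hS * exp(θ b + d κA - t (κA + κS))`. The maximal
inequality therefore bounds the probability that this happens at some `t` in a set `T`
(`cond_real_exists_lt_le`).

Write `κ = κA + κS`. If `κ(θ) ≥ 0` on `t ≤ yd`, or `κ(θ) ≤ 0` on `t > yd`, the exponent is bounded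
below by its value at `t = yd`, namely `d θ_y`; for the backlog replace `yd` by `yb` and take `d =
0`. So only the position of `θ` matters. The convex function `κ` vanishes at `0` and `γ`, and
comparing derivatives at `θ` and `γ` shows that `y < y_γ` forces `θ > γ`, hence `κ(θ) ≥ 0`, while `y
> y_γ` forces `0 ≤ θ < γ`, hence `κ(θ) ≤ 0`.

The analytic input is that `κ` is convex and differentiable. This comes from Perron-Frobenius
theory: convexity by comparing supersolutions (`convexOn_kappa`), differentiability by pairing
continuous right eigenvectors with a left one (`tendsto_perron`, `differentiableAt_kappa`). -/

theorem mulVec_le_mulVec {M : Matrix n n ℝ} (hM : ∀ i j, 0 ≤ M i j) {x y : n → ℝ} (h : x ≤ y) :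
    M.mulVec x ≤ M.mulVec y := fun i =>
  Finset.sum_le_sum fun j _ => mul_le_mul_of_nonneg_left (h j) (hM i j)

/-- Comparison principle: a supersolution with factor `s` dominates every subsolution. -/
theorem le_of_mulVec_le_of_le_mulVec {M N : Matrix n n ℝ} (hM : ∀ i j, 0 ≤ M i j)
    (hMN : ∀ i j, M i j ≤ N i j)
    {x y : n → ℝ} {r s : ℝ} (hx : ∀ i, 0 < x i) (hy : ∀ i, 0 ≤ y i) (hy0 : y ≠ 0)
    (hsx : ∀ i, N.mulVec x i ≤ s * x i) (hry : ∀ i, r * y i ≤ M.mulVec y i) : r ≤ s := by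
  obtain ⟨k, hk⟩ := Function.ne_iff.1 hy0
  have : Nonempty n := ⟨k⟩
  -- Where `y / x` is maximal, `y` lies below a multiple of `x` that touches it at `i`; comparing
  -- both inequalities there gives `r ≤ s`.
  obtain ⟨i, hi⟩ := Finite.exists_max fun i => y i / x i
  have hle : ∀ j, y j ≤ y i / x i * x j := fun j => (div_le_iff₀ (hx j)).1 (hi j)
  have hpos : 0 < y i / x i :=
    (div_pos ((hy k).lt_of_ne' hk) (hx k)).trans_le (hi k)
  have hyi : 0 < y i := by
    by_contra h
    rw [le_antisymm (not_lt.1 h) (hy i)] at hpos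
    simp at hpos
  have key : r * y i ≤ s * y i :=
    calc r * y i ≤ M.mulVec y i := hry i
      _ ≤ N.mulVec ((y i / x i) • x) i := Finset.sum_le_sum fun j _ =>
          mul_le_mul (hMN i j) (hle j) (hy j) ((hM i j).trans (hMN i j))
      _ = y i / x i * N.mulVec x i := by rw [mulVec_smul]; rfl
      _ ≤ y i / x i * (s * x i) := mul_le_mul_of_nonneg_left (hsx i) hpos.le
      _ = s * y i := by have := (hx i).ne'; field_simp
  exact le_of_mul_le_mul_right key hyi

variable [DecidableEq n]

theorem pow_mulVec_le {M : Matrix n n ℝ} (hM : ∀ i j, 0 ≤ M i j) {x : n → ℝ} {s : ℝ} (hs : 0 ≤ s)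
    (h : M.mulVec x ≤ s • x) (k : ℕ) : (M ^ k).mulVec x ≤ s ^ k • x := by
  induction k with
  | zero => simp
  | succ k ih =>
    rw [pow_succ', ← mulVec_mulVec]
    refine (mulVec_le_mulVec hM ih).trans ?_
    rw [mulVec_smul, pow_succ, mul_smul]
    intro i
    exact mul_le_mul_of_nonneg_left (h i) (pow_nonneg hs k)

/-- A nonzero nonnegative supersolution of an irreducible matrix is positive. -/
theorem IsIrreducible.pos_of_mulVec_le {M : Matrix n n ℝ} (hM : M.IsIrreducible) {x : n → ℝ}
    {s : ℝ} (hs : 0 ≤ s) (hx : ∀ i, 0 ≤ x i) (hx0 : x ≠ 0) (h : M.mulVec x ≤ s • x) :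
    0 < s ∧ ∀ i, 0 < x i := by
  obtain ⟨j, hj⟩ := Function.ne_iff.1 hx0
  have hxj : 0 < x j := (hx j).lt_of_ne' hj
  -- A path from `i` to `j` carries the mass `x j` to the coordinate `i`. Having `k > 0` is what
  -- later excludes `s = 0`.
  have key : ∀ i, ∃ k > 0, 0 < s ^ k * x i := fun i => by
    obtain ⟨k, hk, hpos⟩ := (isIrreducible_iff_exists_pow_pos hM.nonneg).1 hM i j
    refine ⟨k, hk, (mul_pos hpos hxj).trans_le (le_trans ?_ (pow_mulVec_le hM.nonneg hs h k i))⟩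
    exact Finset.single_le_sum (f := fun l => (M ^ k) i l * x l)
      (fun l _ => mul_nonneg (pow_apply_nonneg hM.nonneg k i l) (hx l)) (Finset.mem_univ j)
  constructor
  · obtain ⟨k, hk, hpos⟩ := key j
    rcases hs.eq_or_lt with rfl | h'
    · simp [hk.ne'] at hpos
    · exact h'
  · intro i
    obtain ⟨k, hk, hpos⟩ := key i
    exact pos_of_mul_pos_right hpos (pow_nonneg hs k)

/-- Some polynomial in an irreducible matrix is entrywise positive. -/
theorem IsIrreducible.exists_commute_pos {M : Matrix n n ℝ} (hM : M.IsIrreducible) :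
    ∃ N : Matrix n n ℝ, Commute M N ∧ ∀ i j, 0 < N i j := by
  choose k hk hpos using (isIrreducible_iff_exists_pow_pos hM.nonneg).1 hM
  refine ⟨∑ l ∈ Finset.range (∑ i, ∑ j, k i j + 1), M ^ l,
    Commute.sum_right _ _ _ fun l _ => Commute.pow_right (Commute.refl M) l, fun i j => ?_⟩
  rw [Matrix.sum_apply]
  refine (hpos i j).trans_le (Finset.single_le_sum (f := fun l => (M ^ l) i j)
    (fun l _ => pow_apply_nonneg hM.nonneg l i j) (Finset.mem_range.2 (Nat.lt_succ_of_le ?_)))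
  exact (Finset.single_le_sum (f := fun j => k i j) (fun _ _ => Nat.zero_le _)
    (Finset.mem_univ j)).trans (Finset.single_le_sum (f := fun i => ∑ j, k i j)
    (fun _ _ => Nat.zero_le _) (Finset.mem_univ i))

/-- Perron-Frobenius: an irreducible nonnegative matrix has a positive eigenvector in the
standard simplex, with positive eigenvalue. -/
theorem IsIrreducible.exists_perron [Nonempty n] {M : Matrix n n ℝ} (hM : M.IsIrreducible) :
    ∃ (r : ℝ) (v : n → ℝ), 0 < r ∧ (∀ i, 0 < v i) ∧ ∑ i, v i = 1 ∧ M.mulVec v = r • v := by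
  have hcard : 0 < (Fintype.card n : ℝ) := by exact_mod_cast Fintype.card_pos
  have hs₀ : 0 ≤ ∑ i, ∑ j, M i j :=
    Finset.sum_nonneg fun i _ => Finset.sum_nonneg fun j _ => hM.nonneg i j
  set s₀ := ∑ i, ∑ j, M i j
  -- Pairs of a factor and a normalized supersolution. The bound `s₀` makes `K` compact and lets the
  -- uniform vector belong to it; the Perron pair is a minimizer of the factor.
  set K : Set (ℝ × (n → ℝ)) :=
    (Set.Icc 0 s₀ ×ˢ stdSimplex ℝ n) ∩ {p | M.mulVec p.2 ≤ p.1 • p.2} with hK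
  have hcont : Continuous fun p : ℝ × (n → ℝ) => M.mulVec p.2 :=
    continuous_const.matrix_mulVec continuous_snd
  have hKc : IsCompact K := (isCompact_Icc.prod (isCompact_stdSimplex ℝ n)).inter_right
    (isClosed_le hcont (continuous_fst.smul continuous_snd))
  have hKne : K.Nonempty := by
    refine ⟨(s₀, fun _ => (Fintype.card n : ℝ)⁻¹), ⟨⟨⟨hs₀, le_rfl⟩, fun _ => by positivity, ?_⟩, ?_⟩⟩
    · simp
    · intro i
      simp only [mulVec, dotProduct, Pi.smul_apply, smul_eq_mul, ← Finset.sum_mul]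
      refine mul_le_mul_of_nonneg_right ?_ (by positivity)
      exact Finset.single_le_sum (f := fun i => ∑ j, M i j)
        (fun i _ => Finset.sum_nonneg fun j _ => hM.nonneg i j) (Finset.mem_univ i)
  obtain ⟨⟨s, x⟩, ⟨⟨hs, hx⟩, hsx⟩, hmin⟩ := hKc.exists_isMinOn hKne continuous_fst.continuousOn
  change M.mulVec x ≤ s • x at hsx
  have hx0 : x ≠ 0 := by
    rintro rfl
    simpa using hx.2
  obtain ⟨hspos, hxpos⟩ := hM.pos_of_mulVec_le hs.1 hx.1 hx0 hsx
  refine ⟨s, x, hspos, hxpos, hx.2, ?_⟩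
  by_contra hne
  -- If the minimizer is not an eigenvector, its defect `z` is nonzero and a positive commuting `N`
  -- makes it strictly positive, so `N x` is a supersolution with a smaller factor.
  obtain ⟨N, hcomm, hN⟩ := hM.exists_commute_pos
  set z := s • x - M.mulVec x with hz
  have hz_nonneg : ∀ i, 0 ≤ z i := fun i => sub_nonneg.2 (hsx i)
  have hNpos : ∀ w : n → ℝ, (∀ i, 0 ≤ w i) → w ≠ 0 → ∀ i, 0 < N.mulVec w i := by
    intro w hw hw0 i
    obtain ⟨j, hj⟩ := Function.ne_iff.1 hw0
    exact Finset.sum_pos' (fun l _ => mul_nonneg (hN i l).le (hw l))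
      ⟨j, Finset.mem_univ j, mul_pos (hN i j) ((hw j).lt_of_ne' hj)⟩
  have hNz := hNpos z hz_nonneg (sub_ne_zero.2 (Ne.symm hne))
  set x' := N.mulVec x with hx'
  have hx'pos := hNpos x hx.1 hx0
  have hMx' : M.mulVec x' = s • x' - N.mulVec z := by
    rw [hz, mulVec_sub, mulVec_smul, hx', mulVec_mulVec, hcomm.eq, ← mulVec_mulVec]
    abel
  have hlt : ∀ i, M.mulVec x' i / x' i < s := fun i => by
    rw [div_lt_iff₀ (hx'pos i), hMx']
    exact sub_lt_self _ (hNz i)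
  obtain ⟨i, hi⟩ := Finite.exists_max fun i => M.mulVec x' i / x' i
  set c := ∑ j, x' j
  have hc : 0 < c := Finset.sum_pos (fun j _ => hx'pos j) Finset.univ_nonempty
  have hmem : (M.mulVec x' i / x' i, c⁻¹ • x') ∈ K := by
    refine ⟨⟨⟨?_, (hlt i).le.trans hs.2⟩, fun j => ?_, ?_⟩, fun j => ?_⟩
    · exact div_nonneg (Finset.sum_nonneg fun j _ => mul_nonneg (hM.nonneg i j) (hx'pos j).le)
        (hx'pos i).le
    · exact mul_nonneg (inv_nonneg.2 hc.le) (hx'pos j).le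
    · simp only [Pi.smul_apply, smul_eq_mul, ← Finset.mul_sum]
      exact inv_mul_cancel₀ hc.ne'
    · have := (div_le_iff₀ (hx'pos j)).1 (hi j)
      simp only [mulVec_smul, Pi.smul_apply, smul_eq_mul]
      calc c⁻¹ * M.mulVec x' j ≤ c⁻¹ * (M.mulVec x' i / x' i * x' j) :=
            mul_le_mul_of_nonneg_left this (inv_nonneg.2 hc.le)
        _ = _ := by ring
  exact absurd (hmin hmem) (not_le.2 (hlt i))

/-- Nonnegative eigenvectors for the Perron eigenvalue are unique in the standard simplex. -/
theorem IsIrreducible.perron_unique {M : Matrix n n ℝ} (hM : M.IsIrreducible) {r : ℝ} (hr : 0 ≤ r)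
    {v w : n → ℝ} (hv : ∀ i, 0 < v i) (hv1 : ∑ i, v i = 1) (hMv : M.mulVec v = r • v)
    (hw1 : ∑ i, w i = 1) (hMw : M.mulVec w = r • w) : w = v := by
  have : Nonempty n := by
    by_contra h
    rw [not_nonempty_iff] at h
    simp at hv1
  -- The largest multiple of `v` below `w` leaves a nonnegative eigenvector with a zero coordinate,
  -- which must vanish identically.
  obtain ⟨i, hi⟩ := Finite.exists_min fun i => w i / v i
  set c := w i / v i with hc
  have hge : ∀ j, 0 ≤ (w - c • v) j := fun j =>
    sub_nonneg.2 ((le_div_iff₀ (hv j)).1 (hi j))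
  have hzero : w - c • v = 0 := by
    by_contra h0
    have := (hM.pos_of_mulVec_le hr hge h0 (le_of_eq (by
      rw [mulVec_sub, mulVec_smul, hMv, hMw, smul_sub, smul_comm]))).2 i
    have hvi := (hv i).ne'
    simp [hc, hvi] at this
  have hw : w = c • v := sub_eq_zero.1 hzero
  have hc1 : c = 1 := by
    rw [hw] at hw1
    simpa [← Finset.mul_sum, hv1] using hw1
  rw [hw, hc1, one_smul]

/-- The spectral radius of a nonnegative matrix is the eigenvalue of any positive eigenvector. -/
theorem spectralRadius_eq_of_pos_eigenvector [Nonempty n] {M : Matrix n n ℝ}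
    (hM : ∀ i j, 0 ≤ M i j)
    {r : ℝ} (hr : 0 ≤ r) {v : n → ℝ} (hv : ∀ i, 0 < v i) (hMv : M.mulVec v = r • v) :
    spectralRadius ℂ (M.map (fun x : ℝ => (x : ℂ))) = ENNReal.ofReal r := by
  set C := M.map (fun x : ℝ => (x : ℂ)) with hC
  have hspec : ∀ z : ℂ, z ∈ spectrum ℂ C ↔ ∃ w : n → ℂ, w ≠ 0 ∧ C.mulVec w = z • w := by
    intro z
    rw [← Matrix.spectrum_toLin', ← Module.End.hasEigenvalue_iff_mem_spectrum]
    constructor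
    · intro h
      obtain ⟨w, hw⟩ := h.exists_hasEigenvector
      exact ⟨w, hw.2, by simpa using hw.apply_eq_smul⟩
    · rintro ⟨w, hw0, hw⟩
      exact Module.End.hasEigenvalue_of_hasEigenvector (x := w)
        ⟨Module.End.mem_eigenspace_iff.2 (by simpa using hw), hw0⟩
  apply le_antisymm
  · refine iSup₂_le fun z hz => ?_
    obtain ⟨w, hw0, hw⟩ := (hspec z).1 hz
    have : ‖z‖ ≤ r := by
      -- By the triangle inequality, the moduli of a complex eigenvector form a subsolution with
      -- factor `‖z‖`.
      refine le_of_mulVec_le_of_le_mulVec hM (fun _ _ => le_rfl) hv (y := fun i => ‖w i‖)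
        (fun i => norm_nonneg _) ?_ (fun i => (congrFun hMv i).le) fun i => ?_
      · intro h
        exact hw0 (funext fun i => norm_eq_zero.1 (congrFun h i))
      · have := congrFun hw i
        calc ‖z‖ * ‖w i‖ = ‖C.mulVec w i‖ := by rw [this]; simp
          _ ≤ ∑ j, ‖C i j * w j‖ := norm_sum_le _ _
          _ = M.mulVec (fun i => ‖w i‖) i := by
            simp [hC, mulVec, dotProduct, abs_of_nonneg (hM _ _)]
    rw [← enorm_eq_nnnorm, ← ofReal_norm]
    exact ENNReal.ofReal_le_ofReal this
  · have hmem : (r : ℂ) ∈ spectrum ℂ C := by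
      refine (hspec _).2 ⟨fun i => (v i : ℂ), ?_, ?_⟩
      · intro h
        exact (hv (Classical.arbitrary n)).ne' (by
          simpa using congrFun h (Classical.arbitrary n))
      · ext i
        have := congrFun hMv i
        simp only [mulVec, dotProduct, Pi.smul_apply, smul_eq_mul, hC, map_apply] at this ⊢
        exact_mod_cast congrArg (fun x : ℝ => (x : ℂ)) this
    refine le_trans (le_of_eq ?_) (le_iSup₂ (f := fun (k : ℂ) (_ : k ∈ spectrum ℂ C) =>
      (‖k‖₊ : ENNReal)) (r : ℂ) hmem)
    rw [ENNReal.ofReal, ENNReal.coe_inj]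
    ext
    simp [hr, abs_of_nonneg hr]

end Matrix

/-! ### The function `κ` -/

namespace MarkovAdditive

open Filter Topology

variable {E : Type*} {F : E → E → Measure ℝ}

theorem transitionMatrix_negKernel : transitionMatrix (negKernel F) = transitionMatrix F := by
  ext i j
  simp [negKernel, transitionMatrix, measureReal_def, Measure.map_apply measurable_neg]

theorem expDomain_eq_iInter :
    expDomain F = ⋂ i, ⋂ j, integrableExpSet id (F i j) := by
  ext θ
  simp [expDomain, integrableExpSet]

theorem convex_expDomain : Convex ℝ (expDomain F) := by
  rw [expDomain_eq_iInter]
  exact convex_iInter fun i => convex_iInter fun j => convex_integrableExpSet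

theorem expMatrix_nonneg (θ : ℝ) (i j : E) : 0 ≤ expMatrix F θ i j :=
  integral_nonneg fun _ => (Real.exp_pos _).le

theorem differentiableAt_expMatrix {θ : ℝ} (hθ : θ ∈ interior (expDomain F)) (i j : E) :
    DifferentiableAt ℝ (fun t => expMatrix F t i j) θ := by
  refine differentiableAt_mgf (X := id) (μ := F i j) (interior_mono ?_ hθ)
  intro t ht
  exact ht i j

/-- Irreducibility depends only on which entries are positive, and the weight `e^{θx}` never kills a
nonzero measure. -/
theorem isIrreducible_expMatrix [∀ i j, IsFiniteMeasure (F i j)]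
    (hirr : (transitionMatrix F).IsIrreducible) {θ : ℝ}
    (hθ : θ ∈ expDomain F) : (expMatrix F θ).IsIrreducible := by
  refine ⟨expMatrix_nonneg θ, ?_⟩
  have hq : (expMatrix F θ).toQuiver = (transitionMatrix F).toQuiver := by
    refine congrArg Quiver.mk (funext₂ fun i j => ?_)
    have : 0 < expMatrix F θ i j ↔ 0 < transitionMatrix F i j := by
      by_cases h0 : F i j = 0
      · simp [expMatrix, transitionMatrix, h0]
      · refine iff_of_true (mgf_pos' (X := id) h0 (hθ i j)) ?_
        have : NeZero (F i j) := ⟨h0⟩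
        exact measureReal_univ_pos
    simp only [this]
  rw [hq]
  exact hirr.connected

variable [Fintype E]

theorem IsKernel.isFiniteMeasure (hF : IsKernel F) (i j : E) : IsFiniteMeasure (F i j) := by
  refine ⟨lt_of_le_of_lt ?_ ENNReal.one_lt_top⟩
  rw [← hF i]
  exact Finset.single_le_sum (f := fun j => F i j Set.univ) (fun _ _ => zero_le)
    (Finset.mem_univ j)

theorem IsKernel.negKernel (hF : IsKernel F) : IsKernel (negKernel F) := fun i => by
  simpa [MarkovAdditive.negKernel, Measure.map_apply measurable_neg] using hF i

/-- From here on `κ` is handled through positive eigenvectors alone, without complex spectra. -/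
theorem exp_kappa_eq [DecidableEq E] [Nonempty E] {θ r : ℝ} (hr : 0 < r) {v : E → ℝ} (hv : ∀ i, 0 < v i)
    (h : (expMatrix F θ).mulVec v = r • v) : Real.exp (kappa F θ) = r := by
  rw [kappa, Matrix.spectralRadius_eq_of_pos_eigenvector (expMatrix_nonneg θ) hr.le hv h,
    ENNReal.toReal_ofReal hr.le, Real.exp_log hr]

variable [∀ i j, IsFiniteMeasure (F i j)]

variable [DecidableEq E]

theorem exists_isPerronVector [Nonempty E] (hirr : (transitionMatrix F).IsIrreducible) {θ : ℝ}
    (hθ : θ ∈ expDomain F) : ∃ h, IsPerronVector F θ h ∧ ∑ i, h i = 1 := by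
  obtain ⟨r, v, hr, hv, hv1, hMv⟩ := (isIrreducible_expMatrix hirr hθ).exists_perron
  exact ⟨v, ⟨hv, by rw [exp_kappa_eq hr hv hMv, hMv]⟩, hv1⟩

theorem kappa_zero [Nonempty E] (hF : IsKernel F) : kappa F 0 = 0 := by
  have h : Real.exp (kappa F 0) = 1 := by
    refine exp_kappa_eq one_pos (v := fun _ => 1) (fun _ => one_pos) (funext fun i => ?_)
    have := congrArg ENNReal.toReal (hF i)
    rw [ENNReal.toReal_sum fun j _ => measure_ne_top _ _] at this
    simpa [Matrix.mulVec, dotProduct, expMatrix, measureReal_def] using this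
  simpa using h

/-- For nonnegative increments every entry grows with `θ`, and the comparison principle transfers
this to the eigenvalues. -/
theorem kappa_mono (hirr : (transitionMatrix F).IsIrreducible) [Nonempty E]
    (hnonneg : ∀ i j, ∀ᵐ x ∂(F i j), 0 ≤ x) : MonotoneOn (kappa F) (expDomain F) := by
  intro s hs t ht hst
  obtain ⟨v, hv, hv1⟩ := exists_isPerronVector hirr hs
  obtain ⟨w, hw, -⟩ := exists_isPerronVector hirr ht
  rw [← Real.exp_le_exp]
  refine Matrix.le_of_mulVec_le_of_le_mulVec (expMatrix_nonneg s) (fun i j => ?_) hw.1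
    (fun i => (hv.1 i).le) ?_ (fun i => (congrFun hw.2 i).le) (fun i => (congrFun hv.2 i).ge)
  · refine integral_mono_ae (hs i j) (ht i j) ?_
    filter_upwards [hnonneg i j] with x hx
    exact Real.exp_le_exp.2 (mul_le_mul_of_nonneg_right hst hx)
  · rintro rfl
    simp at hv1

/-- The weighted geometric mean of the Perron vectors at `s` and `t` is a supersolution at `a s + b
t` with factor `exp(a κ(s) + b κ(t))`, by convexity of `exp`. -/
theorem convexOn_kappa [Nonempty E] (hirr : (transitionMatrix F).IsIrreducible) :
    ConvexOn ℝ (expDomain F) (kappa F) := by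
  refine ⟨convex_expDomain, ?_⟩
  intro s hs t ht a b ha hb hab
  have hst := convex_expDomain hs ht ha hb hab
  obtain ⟨v, ⟨hv, hMv⟩, -⟩ := exists_isPerronVector hirr hs
  obtain ⟨w, ⟨hw, hMw⟩, -⟩ := exists_isPerronVector hirr ht
  obtain ⟨z, ⟨hz, hMz⟩, hz1⟩ := exists_isPerronVector hirr hst
  simp only [smul_eq_mul] at hst hMz ⊢
  set κs := kappa F s
  set κt := kappa F t
  set g : E → ℝ := fun i => Real.exp (a * Real.log (v i) + b * Real.log (w i)) with hg
  -- The factors `v j / (e^{κs} v i)` turn the tilted matrix into a stochastic one, so after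
  -- integration and summation over `j` the bracket equals `a + b = 1`.
  have hpt : ∀ i j x, Real.exp ((a * s + b * t) * x) * g j ≤
      Real.exp (a * κs + b * κt) * g i *
        (a * (Real.exp (s * x) * (v j / (Real.exp κs * v i))) +
          b * (Real.exp (t * x) * (w j / (Real.exp κt * w i)))) := by
    intro i j x
    have h := convexOn_exp.2 (Set.mem_univ (s * x + Real.log (v j) - κs - Real.log (v i)))
      (Set.mem_univ (t * x + Real.log (w j) - κt - Real.log (w i))) ha hb hab
    simp only [smul_eq_mul] at h
    have e1 : Real.exp (s * x + Real.log (v j) - κs - Real.log (v i)) =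
        Real.exp (s * x) * (v j / (Real.exp κs * v i)) := by
      rw [Real.exp_sub, Real.exp_sub, Real.exp_add, Real.exp_log (hv i), Real.exp_log (hv j),
        mul_div_assoc, mul_div_assoc, div_div]
    have e2 : Real.exp (t * x + Real.log (w j) - κt - Real.log (w i)) =
        Real.exp (t * x) * (w j / (Real.exp κt * w i)) := by
      rw [Real.exp_sub, Real.exp_sub, Real.exp_add, Real.exp_log (hw i), Real.exp_log (hw j),
        mul_div_assoc, mul_div_assoc, div_div]
    rw [e1, e2] at h
    refine le_trans (le_of_eq ?_) (mul_le_mul_of_nonneg_left h (by positivity))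
    simp only [hg, ← Real.exp_add]
    congr 1
    ring
  have h_int : ∀ i j, expMatrix F (a * s + b * t) i j * g j ≤
      Real.exp (a * κs + b * κt) * g i *
        (a * (expMatrix F s i j * (v j / (Real.exp κs * v i))) +
          b * (expMatrix F t i j * (w j / (Real.exp κt * w i)))) := by
    intro i j
    have i1 := ((hs i j).mul_const (v j / (Real.exp κs * v i))).const_mul a
    have i2 := ((ht i j).mul_const (w j / (Real.exp κt * w i))).const_mul b
    have := integral_mono ((hst i j).mul_const (g j))
      ((i1.add i2).const_mul (Real.exp (a * κs + b * κt) * g i)) (hpt i j)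
    simp only [Pi.add_apply] at this
    rwa [integral_mul_const, integral_const_mul, integral_add i1 i2, integral_const_mul,
      integral_const_mul, integral_mul_const, integral_mul_const] at this
  have hrow : ∀ {θ κ : ℝ} {u : E → ℝ}, (∀ i, 0 < u i) →
      (expMatrix F θ).mulVec u = Real.exp κ • u → ∀ i,
      ∑ j, expMatrix F θ i j * (u j / (Real.exp κ * u i)) = 1 := by
    intro θ κ u hu h i
    have := congrFun h i
    simp only [Matrix.mulVec, dotProduct, Pi.smul_apply, smul_eq_mul] at this
    simp only [← mul_div_assoc, ← Finset.sum_div, this]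
    exact div_self (mul_pos (Real.exp_pos _) (hu i)).ne'
  rw [← Real.exp_le_exp]
  refine Matrix.le_of_mulVec_le_of_le_mulVec (expMatrix_nonneg _) (fun _ _ => le_rfl) (x := g)
    (fun i => Real.exp_pos _) (fun i => (hz i).le) ?_ (fun i => ?_) (fun i => (congrFun hMz i).ge)
  · rintro rfl
    simp at hz1
  · calc (expMatrix F (a * s + b * t)).mulVec g i ≤ _ := Finset.sum_le_sum fun j _ => h_int i j
      _ = Real.exp (a * κs + b * κt) * g i := by
        rw [← Finset.mul_sum, Finset.sum_add_distrib, ← Finset.mul_sum, ← Finset.mul_sum,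
          hrow hv hMv, hrow hw hMw, mul_one, mul_one, hab, mul_one]

theorem continuousAt_kappa [Nonempty E] (hirr : (transitionMatrix F).IsIrreducible) {θ : ℝ}
    (hθ : θ ∈ interior (expDomain F)) : ContinuousAt (kappa F) θ :=
  (((convexOn_kappa hirr).subset interior_subset convex_expDomain.interior).continuousOn
    isOpen_interior).continuousAt (isOpen_interior.mem_nhds hθ)

/-- The normalized Perron eigenvector depends continuously on the parameter. -/
theorem tendsto_perron [Nonempty E] (hirr : (transitionMatrix F).IsIrreducible) {θ : ℝ}
    (hθ : θ ∈ interior (expDomain F)) {v : ℝ → E → ℝ}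
    (hv : ∀ t ∈ expDomain F, IsPerronVector F t (v t) ∧ ∑ i, v t i = 1) :
    Tendsto v (𝓝 θ) (𝓝 (v θ)) := by
  have hdom : ∀ᶠ t in 𝓝 θ, t ∈ expDomain F :=
    mem_of_superset (isOpen_interior.mem_nhds hθ) interior_subset
  have hmem : ∀ᶠ t in 𝓝 θ, v t ∈ stdSimplex ℝ E := by
    filter_upwards [hdom] with t ht
    exact ⟨fun i => ((hv t ht).1.1 i).le, (hv t ht).2⟩
  obtain ⟨⟨hpos, heig⟩, hsum⟩ := hv θ (interior_subset hθ)
  -- In the compact simplex it suffices that each cluster point is an eigenvector at `θ`; uniqueness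
  -- identifies it.
  refine (isCompact_stdSimplex ℝ E).tendsto_nhds_of_unique_mapClusterPt hmem fun w hw hcl => ?_
  refine (isIrreducible_expMatrix hirr (interior_subset hθ)).perron_unique (Real.exp_pos _).le hpos
    hsum heig hw.2 ?_
  have hbound : ∀ j, ∀ᶠ t in 𝓝 θ, ‖v t j‖ ≤ 1 := fun j => by
    filter_upwards [hmem] with t ht
    rw [Real.norm_of_nonneg (ht.1 j), ← ht.2]
    exact Finset.single_le_sum (f := v t) (fun i _ => ht.1 i) (Finset.mem_univ j)
  have hlim : Tendsto (fun t => (expMatrix F θ).mulVec (v t) - Real.exp (kappa F θ) • v t) (𝓝 θ)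
      (𝓝 0) := by
    rw [tendsto_pi_nhds]
    intro i
    have h1 : Tendsto (fun t => ∑ j, (expMatrix F θ i j - expMatrix F t i j) * v t j) (𝓝 θ)
        (𝓝 (∑ j : E, (0 : ℝ))) := by
      refine tendsto_finsetSum _ fun j _ => ?_
      refine Tendsto.zero_mul_isBoundedUnder_le ?_ ⟨1, hbound j⟩
      simpa using (tendsto_const_nhds (x := expMatrix F θ i j)).sub
        (differentiableAt_expMatrix hθ i j).continuousAt.tendsto
    have h2 : Tendsto (fun t => (Real.exp (kappa F t) - Real.exp (kappa F θ)) * v t i) (𝓝 θ)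
        (𝓝 0) := by
      refine Tendsto.zero_mul_isBoundedUnder_le ?_ ⟨1, hbound i⟩
      simpa using (Real.continuous_exp.continuousAt.comp
        (continuousAt_kappa hirr hθ)).tendsto.sub_const (Real.exp (kappa F θ))
    have h3 := h1.add h2
    simp only [Finset.sum_const_zero, add_zero] at h3
    refine h3.congr' ?_
    filter_upwards [hdom] with t ht
    have := congrFun (hv t ht).1.2 i
    simp only [Matrix.mulVec, dotProduct, Pi.smul_apply, smul_eq_mul, Pi.sub_apply, sub_mul,
      Finset.sum_sub_distrib] at this ⊢
    linarith
  have hcont : Continuous fun x : E → ℝ =>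
      (expMatrix F θ).mulVec x - Real.exp (kappa F θ) • x :=
    (continuous_const.matrix_mulVec continuous_id).sub (continuous_const_smul _)
  have hcl' := hcl.continuousAt_comp hcont.continuousAt
  have := ClusterPt.mono hcl' hlim
  exact sub_eq_zero.1 (eq_of_nhds_neBot this)

/-- Since `deriv` is zero at points of non-differentiability, the hypotheses on `θ` and `γ` carry
information only through this result. Pairing with a left eigenvector `u` at `θ` cancels the
variation of the right eigenvector, so its continuity suffices. -/
theorem differentiableAt_kappa [Nonempty E] (hirr : (transitionMatrix F).IsIrreducible) {θ : ℝ}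
    (hθ : θ ∈ interior (expDomain F)) : DifferentiableAt ℝ (kappa F) θ := by
  have hθ' := interior_subset hθ
  choose! v hv using fun t (ht : t ∈ expDomain F) => exists_isPerronVector hirr ht
  have hlim := tendsto_perron hirr hθ hv
  obtain ⟨r, u, -, hu, -, hMu⟩ := (isIrreducible_expMatrix hirr hθ').transpose.exists_perron
  have hdot : ∀ x, u ⬝ᵥ (expMatrix F θ).mulVec x = r * u ⬝ᵥ x := fun x => by
    rw [Matrix.dotProduct_mulVec, ← Matrix.mulVec_transpose, hMu, smul_dotProduct, smul_eq_mul]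
  have huv : ∀ t ∈ expDomain F, 0 < u ⬝ᵥ v t := fun t ht =>
    Finset.sum_pos (fun i _ => mul_pos (hu i) ((hv t ht).1.1 i)) Finset.univ_nonempty
  have hr : r = Real.exp (kappa F θ) := by
    have := hdot (v θ)
    rw [(hv θ hθ').1.2, dotProduct_smul, smul_eq_mul] at this
    exact (mul_right_cancel₀ (huv θ hθ').ne' this).symm
  set L : ℝ → ℝ := fun t => Real.exp (kappa F t) with hL
  have hslope : Tendsto (slope L θ) (𝓝[≠] θ)
      (𝓝 ((∑ i, ∑ j, u i * (deriv (fun t => expMatrix F t i j) θ * v θ j)) / u ⬝ᵥ v θ)) := by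
    have hnum : Tendsto (fun t => ∑ i, ∑ j, u i * (slope (fun t => expMatrix F t i j) θ t * v t j))
        (𝓝[≠] θ) (𝓝 (∑ i, ∑ j, u i * (deriv (fun t => expMatrix F t i j) θ * v θ j))) := by
      refine tendsto_finsetSum _ fun i _ => tendsto_finsetSum _ fun j _ => ?_
      refine (Tendsto.mul ?_ ?_).const_mul _
      · exact hasDerivAt_iff_tendsto_slope.1 (differentiableAt_expMatrix hθ i j).hasDerivAt
      · exact ((tendsto_pi_nhds.1 hlim) j).mono_left nhdsWithin_le_nhds
    have hden : Tendsto (fun t => u ⬝ᵥ v t) (𝓝[≠] θ) (𝓝 (u ⬝ᵥ v θ)) := by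
      refine tendsto_finsetSum _ fun i _ => ?_
      exact (((tendsto_pi_nhds.1 hlim) i).mono_left nhdsWithin_le_nhds).const_mul _
    refine (hnum.div hden (huv θ hθ').ne').congr' ?_
    have hdom : ∀ᶠ t in 𝓝[≠] θ, t ∈ expDomain F :=
      nhdsWithin_le_nhds (mem_of_superset (isOpen_interior.mem_nhds hθ) interior_subset)
    filter_upwards [hdom, self_mem_nhdsWithin] with t ht htθ
    -- The eigenvalue increment is an exact expression in the matrix increment; dividing by `t - θ`
    -- gives the slope.
    have h1 : (L t - L θ) * u ⬝ᵥ v t =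
        ∑ i, ∑ j, u i * ((expMatrix F t i j - expMatrix F θ i j) * v t j) := by
      have e1 : u ⬝ᵥ (expMatrix F t).mulVec (v t) = L t * u ⬝ᵥ v t := by
        rw [(hv t ht).1.2, dotProduct_smul, smul_eq_mul]
      have e2 := hdot (v t)
      rw [hr] at e2
      rw [sub_mul, ← e1, hL, ← e2, ← dotProduct_sub, ← Matrix.sub_mulVec]
      simp [dotProduct, Matrix.mulVec, Finset.mul_sum]
    rw [Pi.div_apply, div_eq_iff (huv t ht).ne', slope_def_field, div_mul_eq_mul_div, h1, Finset.sum_div]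
    refine Finset.sum_congr rfl fun i _ => ?_
    rw [Finset.sum_div]
    refine Finset.sum_congr rfl fun j _ => ?_
    rw [slope_def_field]
    ring
  have hd : DifferentiableAt ℝ L θ := (hasDerivAt_iff_tendsto_slope.2 hslope).differentiableAt
  have := hd.log (Real.exp_pos _).ne'
  simpa [hL] using this

end MarkovAdditive

/-! ### Convex functions with a positive root -/

section ConvexRoot

variable {Θ : Set ℝ} {f : ℝ → ℝ} {x y γ : ℝ}

theorem ConvexOn.add_deriv_mul_le (hf : ConvexOn ℝ Θ f) (hx : x ∈ Θ) (hy : y ∈ Θ)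
    (hd : DifferentiableAt ℝ f x) : f x + deriv f x * (y - x) ≤ f y := by
  rcases lt_trichotomy x y with h | rfl | h
  · have := hf.le_slope_of_hasDerivAt hx hy h hd.hasDerivAt
    rw [slope_def_field, le_div_iff₀ (sub_pos.2 h)] at this
    linarith
  · simp
  · have := hf.slope_le_of_hasDerivAt hy hx h hd.hasDerivAt
    rw [slope_def_field, div_le_iff₀ (sub_pos.2 h)] at this
    linarith

/-- Used to place `θ` to the left or right of `γ`. -/
theorem ConvexOn.lt_of_deriv_lt (hf : ConvexOn ℝ Θ f) (hx : x ∈ Θ) (hy : y ∈ Θ)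
    (hdx : DifferentiableAt ℝ f x) (hdy : DifferentiableAt ℝ f y) (h : deriv f x < deriv f y) :
    x < y := by
  have h1 := hf.add_deriv_mul_le hx hy hdx
  have h2 := hf.add_deriv_mul_le hy hx hdy
  by_contra hxy
  rcases (not_lt.1 hxy).eq_or_lt with rfl | hlt
  · exact lt_irrefl _ h
  · nlinarith

theorem ConvexOn.nonneg_of_root_lt (hf : ConvexOn ℝ Θ f) (hγ : γ ∈ Θ) (hx : x ∈ Θ)
    (hd : DifferentiableAt ℝ f γ) (hroot : f γ = 0) (hderiv : 0 < deriv f γ) (h : γ < x) :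
    0 ≤ f x := by
  have := hf.add_deriv_mul_le hγ hx hd
  nlinarith

/-- If `f` is convex with `f 0 = f γ = 0`, `γ > 0` and `f' γ > 0`, then to the left of `γ` its
derivative can be nonnegative only where the argument is nonnegative and `f` is nonpositive. -/
theorem ConvexOn.nonneg_and_nonpos_of_lt_root (hf : ConvexOn ℝ Θ f) (hγ : γ ∈ Θ) (hx : x ∈ Θ)
    (hdγ : DifferentiableAt ℝ f γ) (hdx : DifferentiableAt ℝ f x) (hγ0 : 0 < γ) (hzero : f 0 = 0)
    (hroot : f γ = 0) (hderiv : 0 < deriv f γ) (h : x < γ) (hx' : 0 ≤ deriv f x) :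
    0 ≤ x ∧ f x ≤ 0 := by
  have hsub := hf.add_deriv_mul_le hx hγ hdx
  refine ⟨?_, by nlinarith⟩
  by_contra hneg
  rw [not_le] at hneg
  -- As `f' γ > 0`, `f` is negative just left of `γ`. If `x < 0`, then `f' x ≥ 0` gives `f x ≤ f z <
  -- 0`, and convexity on `[x, z]` would force `f 0 < 0`.
  obtain ⟨z, hz0, hzγ, hfz⟩ : ∃ z, 0 < z ∧ z < γ ∧ f z < 0 := by
    have h1 : ∀ᶠ t in nhdsWithin γ (Set.Iio γ), f t < f γ := by
      have := hasDerivAt_iff_tendsto_slope.1 hdγ.hasDerivAt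
      have h2 : ∀ᶠ t in nhdsWithin γ {γ}ᶜ, 0 < slope f γ t := this.eventually_const_lt hderiv
      have h3 := h2.filter_mono (nhdsWithin_mono γ (fun t (ht : t < γ) => ht.ne))
      filter_upwards [h3, self_mem_nhdsWithin] with t ht htγ
      rw [slope_def_field] at ht
      have htγ : t - γ < 0 := sub_neg.2 htγ
      rcases div_pos_iff.1 ht with h | h <;> linarith [h.1, h.2]
    obtain ⟨t, h2, h3⟩ := (h1.and (Ioo_mem_nhdsLT hγ0)).exists
    exact ⟨t, h3.1, h3.2, hroot ▸ h2⟩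
  have hz : z ∈ Θ := hf.1.ordConnected.out hx hγ ⟨(hneg.trans hz0).le, hzγ.le⟩
  have hsub' := hf.add_deriv_mul_le hx hz hdx
  have hxz : f x ≤ f z := by nlinarith
  have hmax := hf.le_max_of_mem_Icc hx hz ⟨hneg.le, hz0.le⟩
  rw [max_eq_right hxz, hzero] at hmax
  linarith

end ConvexRoot

/-! ### Nonnegative martingales -/

section NonnegMartingale

open scoped ENNReal

variable {Ω : Type*}

/-- Provides the π-system on which the martingale property for the joint history is checked. -/
theorem MeasurableSpace.sup_eq_generateFrom_inter (m₁ m₂ : MeasurableSpace Ω) :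
    m₁ ⊔ m₂ = MeasurableSpace.generateFrom
      (Set.image2 (· ∩ ·) {s | MeasurableSet[m₁] s} {t | MeasurableSet[m₂] t}) := by
  apply le_antisymm
  · refine sup_le (fun s hs => ?_) fun t ht => ?_
    · exact MeasurableSpace.measurableSet_generateFrom
        ⟨s, hs, Set.univ, MeasurableSet.univ, Set.inter_univ s⟩
    · exact MeasurableSpace.measurableSet_generateFrom
        ⟨Set.univ, MeasurableSet.univ, t, ht, Set.univ_inter t⟩
  · refine MeasurableSpace.generateFrom_le ?_
    rintro _ ⟨s, hs, t, ht, rfl⟩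
    exact MeasurableSet.inter (m := m₁ ⊔ m₂) ((le_sup_left : m₁ ≤ m₁ ⊔ m₂) s hs)
      ((le_sup_right : m₂ ≤ m₁ ⊔ m₂) t ht)

theorem isPiSystem_image2_inter (m₁ m₂ : MeasurableSpace Ω) :
    IsPiSystem (Set.image2 (· ∩ ·) {s | MeasurableSet[m₁] s} {t | MeasurableSet[m₂] t}) := by
  rintro _ ⟨s, hs, t, ht, rfl⟩ _ ⟨s', hs', t', ht', rfl⟩ -
  exact ⟨s ∩ s', MeasurableSet.inter hs hs', t ∩ t', MeasurableSet.inter ht ht',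
    Set.inter_inter_inter_comm s s' t t'⟩

/-- Two functions with equal integrals over the sets of a sub-σ-algebra have equal integrals
against its nonnegative measurable functions. -/
theorem lintegral_mul_eq_of_setLIntegral_eq {m mΩ : MeasurableSpace Ω} {μ : Measure Ω} (hm : m ≤ mΩ)
    {U V : Ω → ℝ≥0∞} (hU : Measurable U) (hV : Measurable V)
    (h : ∀ s, MeasurableSet[m] s → ∫⁻ ω in s, U ω ∂μ = ∫⁻ ω in s, V ω ∂μ) {f : Ω → ℝ≥0∞}
    (hf : Measurable[m] f) {s : Set Ω} (hs : MeasurableSet[m] s) :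
    ∫⁻ ω in s, f ω * U ω ∂μ = ∫⁻ ω in s, f ω * V ω ∂μ := by
  -- The hypothesis says exactly that the densities `U` and `V` define the same measure on `m`.
  have heq : (μ.withDensity U).trim hm = (μ.withDensity V).trim hm := by
    refine @Measure.ext _ m _ _ fun t ht => ?_
    rw [trim_measurableSet_eq hm ht, trim_measurableSet_eq hm ht,
      withDensity_apply _ (hm t ht), withDensity_apply _ (hm t ht), h t ht]
  have key : ∀ W : Ω → ℝ≥0∞, Measurable W →
      ∫⁻ ω in s, f ω * W ω ∂μ = ∫⁻ ω, s.indicator f ω ∂((μ.withDensity W).trim hm) := by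
    intro W hW
    have hfs : Measurable[m] (s.indicator f) := hf.indicator hs
    rw [lintegral_trim hm hfs, lintegral_withDensity_eq_lintegral_mul _ hW (hfs.mono hm le_rfl),
      ← lintegral_indicator (hm s hs)]
    refine lintegral_congr fun ω => ?_
    by_cases hω : ω ∈ s <;> simp [hω, mul_comm]
  rw [key U hU, key V hV, heq]

variable [mΩ : MeasurableSpace Ω]

/-- `X` is a martingale with values in `[0, ∞]` for the filtration `G`. -/
structure IsNonnegMartingale (μ : Measure Ω) (G : ℕ → MeasurableSpace Ω) (X : ℕ → Ω → ℝ≥0∞) :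
    Prop where
  mono : Monotone G
  le : ∀ n, G n ≤ mΩ
  adapted : ∀ n, Measurable[G n] (X n)
  step : ∀ n s, MeasurableSet[G n] s → ∫⁻ ω in s, X (n + 1) ω ∂μ = ∫⁻ ω in s, X n ω ∂μ

namespace IsNonnegMartingale

variable {μ : Measure Ω} {G K : ℕ → MeasurableSpace Ω} {X Y : ℕ → Ω → ℝ≥0∞}

theorem setLIntegral_eq (hX : IsNonnegMartingale μ G X) {m n : ℕ} (hmn : m ≤ n) {s : Set Ω}
    (hs : MeasurableSet[G m] s) : ∫⁻ ω in s, X n ω ∂μ = ∫⁻ ω in s, X m ω ∂μ := by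
  induction n, hmn using Nat.le_induction with
  | base => rfl
  | succ n hmn ih => rw [hX.step n s (hX.mono hmn s hs), ih]

theorem lintegral_eq (hX : IsNonnegMartingale μ G X) (n : ℕ) :
    ∫⁻ ω, X n ω ∂μ = ∫⁻ ω, X 0 ω ∂μ := by
  simpa using hX.setLIntegral_eq (Nat.zero_le n) (s := Set.univ) MeasurableSet.univ

theorem shift (hX : IsNonnegMartingale μ G X) (d : ℕ) :
    IsNonnegMartingale μ (fun n => G (d + n)) (fun n => X (d + n)) where
  mono := fun _ _ h => hX.mono (Nat.add_le_add_left h d)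
  le := fun _ => hX.le _
  adapted := fun _ => hX.adapted _
  step := fun n s hs => hX.step (d + n) s hs

/-- Maximal inequality. -/
theorem mul_measure_iUnion_le (hX : IsNonnegMartingale μ G X) {I : Set Ω}
    (hI : MeasurableSet[G 0] I) {B : ℕ → Set Ω} (hB : ∀ n, MeasurableSet[G n] (B n))
    (hBI : ∀ n, B n ⊆ I) {c : ℝ≥0∞} (hc : ∀ n, ∀ ω ∈ B n, c ≤ X n ω) :
    c * μ (⋃ n, B n) ≤ ∫⁻ ω in I, X 0 ω ∂μ := by
  -- `disjointed B n` is the event that `B` first occurs at time `n`. It is known at time `n`, so `X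
  -- n` can be replaced there by `X N`.
  have hC : ∀ n, MeasurableSet[G n] (disjointed B n) := fun n =>
    disjointed_eq_inter_compl B n ▸ MeasurableSet.inter (hB n)
      (MeasurableSet.iInter fun i => MeasurableSet.iInter fun hi =>
        MeasurableSet.compl (hX.mono hi.le _ (hB i)))
  rw [← iUnion_disjointed, measure_iUnion (disjoint_disjointed B) fun n => hX.le n _ (hC n),
    ← ENNReal.tsum_mul_left]
  refine ENNReal.tsum_le_of_sum_range_le fun N => ?_
  calc ∑ n ∈ Finset.range N, c * μ (disjointed B n)
      ≤ ∑ n ∈ Finset.range N, ∫⁻ ω in disjointed B n, X N ω ∂μ := by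
        refine Finset.sum_le_sum fun n hn => ?_
        rw [hX.setLIntegral_eq (Finset.mem_range.1 hn).le (hC n), ← setLIntegral_const]
        exact setLIntegral_mono' (hX.le n _ (hC n)) fun ω hω => hc n ω (disjointed_subset B n hω)
    _ = ∫⁻ ω in ⋃ n ∈ Finset.range N, disjointed B n, X N ω ∂μ :=
        (lintegral_biUnion_finset (fun i _ j _ hij => disjoint_disjointed B hij)
          (fun n _ => hX.le n _ (hC n)) _).symm
    _ ≤ ∫⁻ ω in I, X N ω ∂μ := lintegral_mono_set
        (Set.iUnion₂_subset fun n _ => (disjointed_subset B n).trans (hBI n))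
    _ = ∫⁻ ω in I, X 0 ω ∂μ := hX.setLIntegral_eq (Nat.zero_le N) hI

end IsNonnegMartingale

theorem setLIntegral_inter_mul_of_indep {μ : Measure Ω} {m₁ m₂ : MeasurableSpace Ω}
    (h₁ : m₁ ≤ mΩ) (h₂ : m₂ ≤ mΩ) (hind : Indep m₁ m₂ μ) {X Y : Ω → ℝ≥0∞}
    (hX : Measurable[m₁] X) (hY : Measurable[m₂] Y) {s t : Set Ω} (hs : MeasurableSet[m₁] s)
    (ht : MeasurableSet[m₂] t) :
    ∫⁻ ω in s ∩ t, X ω * Y ω ∂μ = (∫⁻ ω in s, X ω ∂μ) * ∫⁻ ω in t, Y ω ∂μ := by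
  rw [← lintegral_indicator ((h₁ s hs).inter (h₂ t ht)), ← lintegral_indicator (h₁ s hs),
    ← lintegral_indicator (h₂ t ht),
    ← lintegral_mul_eq_lintegral_mul_lintegral_of_independent_measurableSpace h₁ h₂ hind
      (hX.indicator hs) (hY.indicator ht)]
  refine lintegral_congr fun ω => ?_
  by_cases h1 : ω ∈ s <;> by_cases h2 : ω ∈ t <;> simp [h1, h2]

/-- The product of two independent nonnegative martingales is a martingale for the joint
filtration. -/
theorem IsNonnegMartingale.mul {μ : Measure Ω} {G K : ℕ → MeasurableSpace Ω}
    {X Y : ℕ → Ω → ℝ≥0∞} (hX : IsNonnegMartingale μ G X) (hY : IsNonnegMartingale μ K Y)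
    (hind : ∀ n, Indep (G n) (K n) μ) (hX0 : ∫⁻ ω, X 0 ω ∂μ ≠ ∞) (hY0 : ∫⁻ ω, Y 0 ω ∂μ ≠ ∞) :
    IsNonnegMartingale μ (fun n => G n ⊔ K n) (fun n ω => X n ω * Y n ω) := by
  have hle : ∀ n, G n ⊔ K n ≤ mΩ := fun n => sup_le (hX.le n) (hY.le n)
  have hmeas : ∀ n, Measurable[G n ⊔ K n] fun ω => X n ω * Y n ω := fun n =>
    have hXn : Measurable[G n ⊔ K n] (X n) := (hX.adapted n).mono le_sup_left le_rfl
    have hYn : Measurable[G n ⊔ K n] (Y n) := (hY.adapted n).mono le_sup_right le_rfl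
    hXn.mul hYn
  refine ⟨fun m n h => sup_le_sup (hX.mono h) (hY.mono h), hle, hmeas, fun n s hs => ?_⟩
  have hprod : ∀ k, n ≤ k → ∀ s t, MeasurableSet[G n] s → MeasurableSet[K n] t →
      ∫⁻ ω in s ∩ t, X k ω * Y k ω ∂μ = (∫⁻ ω in s, X n ω ∂μ) * ∫⁻ ω in t, Y n ω ∂μ := by
    intro k hk s t hs ht
    rw [setLIntegral_inter_mul_of_indep (hX.le k) (hY.le k) (hind k) (hX.adapted k)
      (hY.adapted k) (hX.mono hk s hs) (hY.mono hk t ht), hX.setLIntegral_eq hk hs,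
      hY.setLIntegral_eq hk ht]
  -- Finite total mass is needed for uniqueness of measures agreeing on a π-system.
  have huniv : ∫⁻ ω, X (n + 1) ω * Y (n + 1) ω ∂μ ≠ ∞ := by
    have := hprod (n + 1) n.le_succ Set.univ Set.univ MeasurableSet.univ MeasurableSet.univ
    simp only [Set.inter_self, setLIntegral_univ] at this
    rw [this, hX.lintegral_eq, hY.lintegral_eq]
    exact ENNReal.mul_ne_top hX0 hY0
  set ν : ℕ → Measure[G n ⊔ K n] Ω := fun k =>
    (μ.withDensity fun ω => X k ω * Y k ω).trim (hle n) with hν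
  have hνs : ∀ k s, MeasurableSet[G n ⊔ K n] s → ν k s = ∫⁻ ω in s, X k ω * Y k ω ∂μ := by
    intro k s hs
    rw [hν, trim_measurableSet_eq (hle n) hs, withDensity_apply _ (hle n s hs)]
  have : @IsFiniteMeasure _ (G n ⊔ K n) (ν (n + 1)) := by
    refine @IsFiniteMeasure.mk _ (G n ⊔ K n) _ ?_
    rw [hνs _ _ MeasurableSet.univ, setLIntegral_univ]
    exact huniv.lt_top
  have heq : ν (n + 1) = ν n := by
    refine @ext_of_generate_finite _ (G n ⊔ K n) _ _ _
      (MeasurableSpace.sup_eq_generateFrom_inter _ _) (isPiSystem_image2_inter _ _) this ?_ ?_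
    · rintro _ ⟨s, hs, t, ht, rfl⟩
      have hst : MeasurableSet[G n ⊔ K n] (s ∩ t) := MeasurableSet.inter (m := G n ⊔ K n)
        ((le_sup_left : G n ≤ G n ⊔ K n) s hs) ((le_sup_right : K n ≤ G n ⊔ K n) t ht)
      simp only [hνs _ _ hst]
      rw [hprod _ n.le_succ s t hs ht, hprod n le_rfl s t hs ht]
    · have h1 := hprod _ n.le_succ Set.univ Set.univ MeasurableSet.univ MeasurableSet.univ
      have h2 := hprod _ le_rfl Set.univ Set.univ MeasurableSet.univ MeasurableSet.univ
      rw [Set.inter_self] at h1 h2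
      rw [hνs _ _ MeasurableSet.univ, hνs _ _ MeasurableSet.univ, h1, h2]
  rw [← hνs _ s hs, ← hνs _ s hs, heq]

end NonnegMartingale

/-! ### Exponential martingales of Markov additive processes -/

namespace MarkovAdditive

open scoped ENNReal

theorem lintegral_ofReal_comp_ne_top {Ω E : Type*} [MeasurableSpace Ω] [Fintype E] {μ : Measure Ω}
    [IsFiniteMeasure μ] (f : Ω → E) (v : E → ℝ) : ∫⁻ ω, ENNReal.ofReal (v (f ω)) ∂μ ≠ ∞ := by
  refine ne_top_of_le_ne_top (b := ∫⁻ _, ∑ i, ENNReal.ofReal (v i) ∂μ) ?_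
    (lintegral_mono fun ω => Finset.single_le_sum (f := fun i => ENNReal.ofReal (v i))
      (fun _ _ => zero_le) (Finset.mem_univ (f ω)))
  rw [lintegral_const]
  exact ENNReal.mul_ne_top (ENNReal.sum_ne_top.2 fun _ _ => ENNReal.ofReal_ne_top)
    (measure_ne_top _ _)

section ExpMartingale

variable {Ω E : Type*} [MeasurableSpace E] {J : ℕ → Ω → E}
  {S : ℕ → Ω → ℝ}

theorem history_mono : Monotone (history J S) := fun _ _ hst =>
  biSup_mono fun _ hi => le_trans (Set.mem_Iic.1 hi) hst

theorem measurable_history_pair {s t : ℕ} (hst : s ≤ t) :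
    Measurable[history J S t] fun ω => (J s ω, S s ω) :=
  (comap_measurable _).mono
    (le_iSup₂_of_le (f := fun (s : ℕ) (_ : s ∈ Set.Iic t) =>
      MeasurableSpace.comap (fun ω => (J s ω, S s ω)) inferInstance) s hst le_rfl) le_rfl

theorem measurable_history_state {s t : ℕ} (hst : s ≤ t) : Measurable[history J S t] (J s) :=
  measurable_fst.comp (measurable_history_pair hst)

theorem measurable_history_additive {s t : ℕ} (hst : s ≤ t) : Measurable[history J S t] (S s) :=
  measurable_snd.comp (measurable_history_pair hst)

/-- Lets independence of whole paths pass to the histories. -/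
theorem history_le_comap_path (t : ℕ) :
    history J S t ≤ MeasurableSpace.comap (fun ω s => (J s ω, S s ω)) MeasurableSpace.pi := by
  refine iSup₂_le fun s _ => ?_
  have : (fun ω => (J s ω, S s ω)) = (fun p : ℕ → E × ℝ => p s) ∘ fun ω s => (J s ω, S s ω) := rfl
  rw [this, ← MeasurableSpace.comap_comp]
  exact MeasurableSpace.comap_mono (measurable_pi_apply s).comap_le

variable [mΩ : MeasurableSpace Ω] [Fintype E] {μ : Measure Ω} {F : E → E → Measure ℝ}

theorem IsProcess.history_le (hS : IsProcess μ F J S) (t : ℕ) : history J S t ≤ mΩ :=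
  iSup₂_le fun s _ => ((hS.measurable_state s).prodMk (hS.measurable_additive s)).comap_le

variable [MeasurableSingletonClass E] [IsFiniteMeasure μ] [∀ i j, IsFiniteMeasure (F i j)]

/-- Joint law of the next state and increment on an event of the past. -/
theorem IsProcess.measure_inter_step (hS : IsProcess μ F J S) (t : ℕ) {H : Set Ω}
    (hH : MeasurableSet[history J S t] H) (j : E) {B : Set ℝ} (hB : MeasurableSet B) :
    μ (H ∩ J (t + 1) ⁻¹' {j} ∩ (fun ω => S (t + 1) ω - S t ω) ⁻¹' B) =
      ∫⁻ ω in H, F (J t ω) j B ∂μ := by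
  classical
  have hle := hS.history_le t
  have hΔ : Measurable fun ω => S (t + 1) ω - S t ω :=
    (hS.measurable_additive _).sub (hS.measurable_additive _)
  -- Indicators are bounded test functions, hence admissible in the Markov property.
  set f : ℝ → ℝ := B.indicator 1 with hf
  set g : E → ℝ := Set.indicator {j} 1 with hg
  have hfm : Measurable f := measurable_one.indicator hB
  have hgm : Measurable g := measurable_of_finite g
  have hfb : ∀ x, |f x| ≤ 1 := fun x => by
    by_cases hx : x ∈ B <;> simp [hf, hx]
  have hgb : ∀ i, |g i| ≤ 1 := fun i => by
    by_cases hx : i = j <;> simp [hg, hx]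
  set C : Set Ω := J (t + 1) ⁻¹' {j} ∩ (fun ω => S (t + 1) ω - S t ω) ⁻¹' B with hC
  have hCm : MeasurableSet C :=
    ((hS.measurable_state _) (measurableSet_singleton j)).inter (hΔ hB)
  have hfg : (fun ω => f (S (t + 1) ω - S t ω) * g (J (t + 1) ω)) = C.indicator 1 := by
    ext ω
    by_cases h1 : S (t + 1) ω - S t ω ∈ B <;> by_cases h2 : J (t + 1) ω = j <;>
      simp [hf, hg, hC, Set.indicator, h1, h2]
  have h_int : Integrable (fun ω => f (S (t + 1) ω - S t ω) * g (J (t + 1) ω)) μ := by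
    rw [hfg]
    exact (integrable_const (1 : ℝ)).indicator hCm
  have hcond := hS.markov_additive t f g hfm ⟨1, hfb⟩
  have h1 := setIntegral_condExp hle h_int hH
  rw [setIntegral_congr_ae (hle H hH) (hcond.mono fun ω hω _ => hω), hfg,
    integral_indicator_one hCm, measureReal_restrict_apply hCm] at h1
  have h2 : ∀ ω, ∑ j', g j' * ∫ x, f x ∂(F (J t ω) j') = (F (J t ω) j).real B := fun ω => by
    rw [Finset.sum_eq_single j]
    · simp [hg, hf, integral_indicator_one hB]
    · intro j' _ hj'
      simp [hg, hj']
    · simp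
  simp only [h2] at h1
  have hmeasF : Measurable fun ω => F (J t ω) j B :=
    (measurable_of_finite fun i => F i j B).comp (hS.measurable_state t)
  have h3 : ∫ ω in H, (F (J t ω) j).real B ∂μ = (∫⁻ ω in H, F (J t ω) j B ∂μ).toReal :=
    integral_toReal hmeasF.aemeasurable (ae_of_all _ fun ω => measure_lt_top _ _)
  have hfin : ∫⁻ ω in H, F (J t ω) j B ∂μ ≠ ∞ := by
    refine ne_top_of_le_ne_top (b := ∫⁻ ω in H, ∑ i, F i j B ∂μ) ?_ (lintegral_mono fun ω => ?_)
    · rw [lintegral_const]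
      exact ENNReal.mul_ne_top (ENNReal.sum_ne_top.2 fun i _ => measure_ne_top _ _)
        (measure_ne_top _ _)
    · exact Finset.single_le_sum (f := fun i => F i j B) (fun _ _ => zero_le) (Finset.mem_univ _)
  rw [h3, measureReal_def, ENNReal.toReal_eq_toReal_iff' hfin (measure_ne_top _ _)] at h1
  rw [h1, Set.inter_assoc, Set.inter_comm]

/-- Passes from bounded test functions to unbounded ones such as `e^{θx}`: on `H` and `J (t + 1) =
j` the increment has as law a mixture of the measures `F i j`. -/
theorem IsProcess.setLIntegral_step (hS : IsProcess μ F J S) (t : ℕ) {H : Set Ω}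
    (hH : MeasurableSet[history J S t] H) {f : ℝ → ℝ≥0∞} (hf : Measurable f) (g : E → ℝ≥0∞) :
    ∫⁻ ω in H, f (S (t + 1) ω - S t ω) * g (J (t + 1) ω) ∂μ =
      ∫⁻ ω in H, ∑ j, g j * ∫⁻ x, f x ∂(F (J t ω) j) ∂μ := by
  classical
  have hle := hS.history_le t
  have hΔ : Measurable fun ω => S (t + 1) ω - S t ω :=
    (hS.measurable_additive _).sub (hS.measurable_additive _)
  have hsumJ : ∀ φ : E → ℝ≥0∞, ∫⁻ ω in H, φ (J t ω) ∂μ = ∑ i, φ i * μ (H ∩ J t ⁻¹' {i}) := by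
    intro φ
    have : ∀ ω, φ (J t ω) = ∑ i, (J t ⁻¹' {i}).indicator (fun _ => φ i) ω := fun ω => by
      rw [Finset.sum_eq_single (J t ω)] <;> simp +contextual [Set.indicator, eq_comm]
    simp only [this]
    rw [lintegral_finsetSum _ fun i _ =>
      measurable_const.indicator ((hS.measurable_state t) (measurableSet_singleton i))]
    refine Finset.sum_congr rfl fun i _ => ?_
    have hi := (hS.measurable_state t) (measurableSet_singleton i)
    rw [lintegral_indicator_const hi, Measure.restrict_apply hi, Set.inter_comm]
  have hlaw : ∀ j, (μ.restrict (H ∩ J (t + 1) ⁻¹' {j})).map (fun ω => S (t + 1) ω - S t ω) =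
      ∑ i, μ (H ∩ J t ⁻¹' {i}) • F i j := fun j => by
    ext B hB
    rw [Measure.map_apply hΔ hB, Measure.restrict_apply (hΔ hB), Set.inter_comm,
      hS.measure_inter_step t hH j hB, hsumJ fun i => F i j B]
    simp [mul_comm]
  have hj : ∀ j, ∫⁻ ω in H ∩ J (t + 1) ⁻¹' {j}, f (S (t + 1) ω - S t ω) ∂μ =
      ∫⁻ ω in H, ∫⁻ x, f x ∂(F (J t ω) j) ∂μ := fun j => by
    rw [← lintegral_map hf hΔ, hlaw, hsumJ fun i => ∫⁻ x, f x ∂(F i j), lintegral_finsetSum_measure]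
    simp [lintegral_smul_measure, mul_comm]
  have hsplit : ∀ ω, f (S (t + 1) ω - S t ω) * g (J (t + 1) ω) =
      ∑ j, g j * (J (t + 1) ⁻¹' {j}).indicator (fun ω => f (S (t + 1) ω - S t ω)) ω := fun ω => by
    rw [Finset.sum_eq_single (J (t + 1) ω)] <;>
      simp +contextual [Set.indicator, eq_comm, mul_comm]
  simp only [hsplit]
  have hfΔ : Measurable fun ω => f (S (t + 1) ω - S t ω) := hf.comp hΔ
  have hFm : ∀ j, Measurable fun ω => ∫⁻ x, f x ∂(F (J t ω) j) := fun j =>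
    (measurable_of_finite fun i => ∫⁻ x, f x ∂(F i j)).comp (hS.measurable_state t)
  rw [lintegral_finsetSum _ fun j _ => (hfΔ.indicator
    ((hS.measurable_state _) (measurableSet_singleton j))).const_mul _,
    lintegral_finsetSum _ fun j _ => (hFm j).const_mul _]
  refine Finset.sum_congr rfl fun j _ => ?_
  have hm := (hS.measurable_state (t + 1)) (measurableSet_singleton j)
  rw [lintegral_const_mul _ (hfΔ.indicator hm), lintegral_const_mul _ (hFm j), ← hj j,
    lintegral_indicator hm, Measure.restrict_restrict hm, Set.inter_comm]

/-- The exponential martingale of a Markov additive process, started at time `d`. -/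
theorem IsProcess.isNonnegMartingale_exp (hS : IsProcess μ F J S) {θ κ : ℝ} {h : E → ℝ}
    (hh : ∀ i, 0 < h i) (h_int : ∀ i j, Integrable (fun x => Real.exp (θ * x)) (F i j))
    (heig : ∀ i, ∑ j, (∫ x, Real.exp (θ * x) ∂(F i j)) * h j = Real.exp κ * h i) (d : ℕ) :
    IsNonnegMartingale μ (fun n => history J S (d + n)) (fun n ω => ENNReal.ofReal
      (Real.exp (θ * (S (d + n) ω - S d ω) - n * κ) * h (J (d + n) ω))) where
  mono := fun _ _ hmn => history_mono (Nat.add_le_add_left hmn d)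
  le := fun n => hS.history_le _
  adapted := fun n => by
    refine ENNReal.measurable_ofReal.comp (Measurable.mul ?_ ?_)
    · exact Real.measurable_exp.comp ((((measurable_history_additive le_rfl).sub
        (measurable_history_additive (Nat.le_add_right d n))).const_mul θ).sub_const _)
    · exact (measurable_of_finite h).comp (measurable_history_state le_rfl)
  step := fun n s hs => by
    have hpast : Measurable[history J S (d + n)] fun ω =>
        ENNReal.ofReal (Real.exp (θ * (S (d + n) ω - S d ω) - (n + 1) * κ)) :=
      ENNReal.measurable_ofReal.comp (Real.measurable_exp.comp
        ((((measurable_history_additive le_rfl).sub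
          (measurable_history_additive (Nat.le_add_right d n))).const_mul θ).sub_const _))
    have hexp : Measurable fun x : ℝ => ENNReal.ofReal (Real.exp (θ * x)) := by fun_prop
    have hU : Measurable fun ω => ENNReal.ofReal (Real.exp (θ * (S (d + n + 1) ω - S (d + n) ω))) *
        ENNReal.ofReal (h (J (d + n + 1) ω)) :=
      (hexp.comp ((hS.measurable_additive _).sub (hS.measurable_additive _))).mul
        (ENNReal.measurable_ofReal.comp ((measurable_of_finite h).comp (hS.measurable_state _)))
    have hV : Measurable fun ω => ∑ j, ENNReal.ofReal (h j) *
        ∫⁻ x, ENNReal.ofReal (Real.exp (θ * x)) ∂(F (J (d + n) ω) j) :=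
      (measurable_of_finite fun i => ∑ j, ENNReal.ofReal (h j) *
        ∫⁻ x, ENNReal.ofReal (Real.exp (θ * x)) ∂(F i j)).comp (hS.measurable_state _)
    have hrow : ∀ i, ∑ j, ENNReal.ofReal (h j) * ∫⁻ x, ENNReal.ofReal (Real.exp (θ * x)) ∂(F i j) =
        ENNReal.ofReal (Real.exp κ * h i) := fun i => by
      rw [← heig i, ENNReal.ofReal_sum_of_nonneg fun j _ =>
        mul_nonneg (integral_nonneg fun _ => (Real.exp_pos _).le) (hh j).le]
      refine Finset.sum_congr rfl fun j _ => ?_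
      rw [← ofReal_integral_eq_lintegral_ofReal (h_int i j) (ae_of_all _ fun _ => (Real.exp_pos _).le),
        mul_comm, ENNReal.ofReal_mul (integral_nonneg fun _ => (Real.exp_pos _).le)]
    -- The factor determined by the past is pulled out; the eigenvector equation then evaluates the
    -- remaining one-step integral.
    have key := lintegral_mul_eq_of_setLIntegral_eq (μ := μ) (hS.history_le (d + n)) hU hV
      (fun H hH => hS.setLIntegral_step (d + n) hH hexp fun j => ENNReal.ofReal (h j)) hpast hs
    calc _ = _ := ?_
      _ = _ := key
      _ = _ := ?_
    · refine lintegral_congr fun ω => ?_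
      rw [← ENNReal.ofReal_mul (Real.exp_pos _).le, ← ENNReal.ofReal_mul (Real.exp_pos _).le,
        ← mul_assoc, ← Real.exp_add]
      congr 3
      push_cast
      ring_nf
    · refine lintegral_congr fun ω => ?_
      rw [hrow, ← ENNReal.ofReal_mul (Real.exp_pos _).le, ← mul_assoc, ← Real.exp_add]
      congr 3
      ring

end ExpMartingale

/-! ### Maximal inequality for the free process -/

section Bound

variable {Ω E E' : Type*} [MeasurableSpace Ω]
  [Fintype E] [MeasurableSpace E] [MeasurableSingletonClass E]
  [Fintype E'] [MeasurableSpace E'] [MeasurableSingletonClass E']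
  {μ : Measure Ω} [IsProbabilityMeasure μ] {FA : E → E → Measure ℝ} {FS : E' → E' → Measure ℝ}
  [∀ i j, IsFiniteMeasure (FA i j)] [∀ i j, IsFiniteMeasure (FS i j)]
  {JA : ℕ → Ω → E} {A : ℕ → Ω → ℝ} {JS : ℕ → Ω → E'} {S : ℕ → Ω → ℝ}

/-- Exponential bound for the probability that the free process `A(d, ·) - S(0, ·)` exceeds a level
at a time of a prescribed set, given the states of `A` at time `d` and of `S` at time `0`. -/
theorem cond_real_exists_lt_le (hA : IsProcess μ FA JA A) (hS : IsProcess μ FS JS S)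
    (hindep : IndepFun (fun ω t => (JA t ω, A t ω)) (fun ω t => (JS t ω, S t ω)) μ)
    {θ κA κS : ℝ} (hθ : 0 ≤ θ) {hvA : E → ℝ} {hvS : E' → ℝ}
    (hvA_pos : ∀ i, 0 < hvA i) (hvS_pos : ∀ i, 0 < hvS i)
    (hintA : ∀ i j, Integrable (fun x => Real.exp (θ * x)) (FA i j))
    (hintS : ∀ i j, Integrable (fun x => Real.exp (-θ * x)) (FS i j))
    (heigA : ∀ i, ∑ j, (∫ x, Real.exp (θ * x) ∂(FA i j)) * hvA j = Real.exp κA * hvA i)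
    (heigS : ∀ i, ∑ j, (∫ x, Real.exp (-θ * x) ∂(FS i j)) * hvS j = Real.exp κS * hvS i)
    (d : ℕ) (iA : E) (iS : E') {T : Set ℕ} {b c : ℝ}
    (hc : ∀ t ∈ T, d ≤ t → c ≤ θ * b + d * κA - t * (κA + κS)) :
    (cond μ {ω | JA d ω = iA ∧ JS 0 ω = iS}).real
        {ω | ∃ t ∈ T, d ≤ t ∧ b < cumul (A · ω) d t - cumul (S · ω) 0 t} ≤
      hvA iA * hvS iS / ((⨅ j, hvA j) * ⨅ j, hvS j) * Real.exp (-c) := by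
  have : Nonempty E := ⟨iA⟩
  have : Nonempty E' := ⟨iS⟩
  obtain ⟨kA, hkA⟩ := Finite.exists_min hvA
  obtain ⟨kS, hkS⟩ := Finite.exists_min hvS
  have hmA : ⨅ j, hvA j = hvA kA :=
    le_antisymm (ciInf_le (Set.finite_range _).bddBelow kA) (le_ciInf hkA)
  have hmS : ⨅ j, hvS j = hvS kS :=
    le_antisymm (ciInf_le (Set.finite_range _).bddBelow kS) (le_ciInf hkS)
  rw [hmA, hmS]
  have hposA := hvA_pos kA
  have hposS := hvS_pos kS
  have hXA := hA.isNonnegMartingale_exp hvA_pos hintA heigA d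
  have hXS₀ := hS.isNonnegMartingale_exp hvS_pos hintS heigS 0
  -- The service martingale starts at time `0` and is observed from `d` on, whereas the arrival
  -- martingale starts at `d`. This is why only `κA` contributes a term in `d` to the exponent.
  have hXS := hXS₀.shift d
  have hind : ∀ n, Indep (history JA A (d + n)) (history JS S (0 + (d + n))) μ := fun n =>
    indep_of_indep_of_le_left (indep_of_indep_of_le_right hindep (history_le_comap_path _))
      (history_le_comap_path _)
  have hfinA : ∫⁻ ω, ENNReal.ofReal (Real.exp (θ * (A (d + 0) ω - A d ω) - (0 : ℕ) * κA) *
      hvA (JA (d + 0) ω)) ∂μ ≠ ∞ := by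
    simp only [add_zero, sub_self, mul_zero, Nat.cast_zero, zero_mul, Real.exp_zero, one_mul]
    exact lintegral_ofReal_comp_ne_top (JA d) hvA
  have hfinS : ∫⁻ ω, ENNReal.ofReal (Real.exp (-θ * (S (0 + (d + 0)) ω - S 0 ω) -
      (d + 0 : ℕ) * κS) * hvS (JS (0 + (d + 0)) ω)) ∂μ ≠ ∞ := by
    rw [hXS₀.lintegral_eq (d + 0)]
    simp only [add_zero, sub_self, mul_zero, Nat.cast_zero, zero_mul, Real.exp_zero, one_mul]
    exact lintegral_ofReal_comp_ne_top (JS 0) hvS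
  have hM := hXA.mul hXS hind hfinA hfinS
  set IA : Set Ω := JA d ⁻¹' {iA} with hIA
  set IS : Set Ω := JS 0 ⁻¹' {iS} with hIS
  have hI : {ω | JA d ω = iA ∧ JS 0 ω = iS} = IA ∩ IS := rfl
  have hIAm : MeasurableSet[history JA A (d + 0)] IA :=
    measurable_history_state (Nat.le_add_right d 0) (measurableSet_singleton iA)
  have hISm₀ : MeasurableSet[history JS S (0 + 0)] IS :=
    measurable_history_state (Nat.zero_le _) (measurableSet_singleton iS)
  have hISm : MeasurableSet[history JS S (0 + (d + 0))] IS :=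
    measurable_history_state (Nat.zero_le _) (measurableSet_singleton iS)
  have hIm : MeasurableSet[history JA A (d + 0) ⊔ history JS S (0 + (d + 0))] (IA ∩ IS) :=
    MeasurableSet.inter (m := history JA A (d + 0) ⊔ history JS S (0 + (d + 0)))
      ((le_sup_left : _ ≤ history JA A (d + 0) ⊔ history JS S (0 + (d + 0))) _ hIAm)
      ((le_sup_right : _ ≤ history JA A (d + 0) ⊔ history JS S (0 + (d + 0))) _ hISm)
  set B : ℕ → Set Ω := fun n =>
    {ω | d + n ∈ T ∧ ω ∈ IA ∩ IS ∧ b < cumul (A · ω) d (d + n) - cumul (S · ω) 0 (d + n)} with hB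
  have hIn : ∀ n, MeasurableSet[history JA A (d + n) ⊔ history JS S (0 + (d + n))] (IA ∩ IS) :=
    fun n => hM.mono (Nat.zero_le n) _ hIm
  have hBm : ∀ n, MeasurableSet[history JA A (d + n) ⊔ history JS S (0 + (d + n))] (B n) := by
    intro n
    set m := history JA A (d + n) ⊔ history JS S (0 + (d + n)) with hm
    have hAle : history JA A (d + n) ≤ m := le_sup_left
    have hSle : history JS S (0 + (d + n)) ≤ m := le_sup_right
    by_cases hT : d + n ∈ T
    · have h1 : Measurable[m] fun ω => cumul (A · ω) d (d + n) - cumul (S · ω) 0 (d + n) :=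
        (((measurable_history_additive le_rfl).mono hAle le_rfl).sub
          ((measurable_history_additive (Nat.le_add_right d n)).mono hAle le_rfl)).sub
        (((measurable_history_additive (Nat.le_add_left _ 0)).mono hSle le_rfl).sub
          ((measurable_history_additive (Nat.zero_le _)).mono hSle le_rfl))
      have h2 : B n = (IA ∩ IS) ∩
          (fun ω => cumul (A · ω) d (d + n) - cumul (S · ω) 0 (d + n)) ⁻¹' Set.Ioi b := by
        ext ω
        simp only [hB, hT, true_and]
        rfl
      rw [h2]
      exact MeasurableSet.inter (hIn n) (h1 measurableSet_Ioi)
    · have : B n = ∅ := by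
        ext ω
        simp [hB, hT]
      rw [this]
      exact MeasurableSet.empty
  have hmax := hM.mul_measure_iUnion_le hIm hBm (fun n ω hω => hω.2.1)
    (c := ENNReal.ofReal (hvA kA * hvS kS * Real.exp c)) fun n ω hω => by
      rw [← ENNReal.ofReal_mul (mul_pos (Real.exp_pos _) (hvA_pos _)).le]
      refine ENNReal.ofReal_le_ofReal ?_
      have h1 := hc (d + n) hω.1 (Nat.le_add_right d n)
      have h2 : θ * b ≤ θ * (cumul (A · ω) d (d + n) - cumul (S · ω) 0 (d + n)) :=
        mul_le_mul_of_nonneg_left hω.2.2.le hθ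
      simp only [cumul, zero_add] at h2 ⊢
      push_cast at h1 ⊢
      calc hvA kA * hvS kS * Real.exp c
          ≤ hvA (JA (d + n) ω) * hvS (JS (d + n) ω) *
            Real.exp (θ * (A (d + n) ω - A d ω) - n * κA +
              (-θ * (S (d + n) ω - S 0 ω) - (d + n) * κS)) := by
            refine mul_le_mul (mul_le_mul (hkA _) (hkS _) hposS.le (hvA_pos _).le)
              (Real.exp_le_exp.2 (by linarith)) (Real.exp_pos _).le
              (mul_pos (hvA_pos _) (hvS_pos _)).le
        _ = _ := by rw [Real.exp_add]; ring
  -- Since `IS` belongs to the history at time `0`, the service factor can be moved back from time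
  -- `d` to time `0`, where it equals `hvS iS`.
  have hstart : ∫⁻ ω in IA ∩ IS, ENNReal.ofReal (Real.exp (θ * (A (d + 0) ω - A d ω) -
      (0 : ℕ) * κA) * hvA (JA (d + 0) ω)) * ENNReal.ofReal (Real.exp (-θ * (S (0 + (d + 0)) ω -
      S 0 ω) - (d + 0 : ℕ) * κS) * hvS (JS (0 + (d + 0)) ω)) ∂μ =
      ENNReal.ofReal (hvA iA * hvS iS) * μ (IA ∩ IS) := by
    rw [setLIntegral_inter_mul_of_indep (hXA.le 0) (hXS.le 0) (hind 0) (hXA.adapted 0)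
      (hXS.adapted 0) hIAm hISm, hXS₀.setLIntegral_eq (Nat.zero_le (d + 0)) hISm₀,
      (Indep_iff _ _ μ).1 (hind 0) _ _ hIAm hISm]
    simp only [add_zero, sub_self, mul_zero, Nat.cast_zero, zero_mul, Real.exp_zero, one_mul]
    rw [setLIntegral_congr_fun (g := fun _ => ENNReal.ofReal (hvA iA)) (hXA.le 0 _ hIAm)
        (fun ω hω => by rw [show JA d ω = iA from hω]),
      setLIntegral_congr_fun (g := fun _ => ENNReal.ofReal (hvS iS)) (hXS.le 0 _ hISm)
        (fun ω hω => by rw [show JS 0 ω = iS from hω]),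
      setLIntegral_const, setLIntegral_const, ENNReal.ofReal_mul (hvA_pos iA).le]
    ring
  rw [hstart] at hmax
  have hreal := ENNReal.toReal_mono (ENNReal.mul_ne_top ENNReal.ofReal_ne_top
    (measure_ne_top _ _)) hmax
  rw [ENNReal.toReal_mul, ENNReal.toReal_mul, ENNReal.toReal_ofReal (by positivity),
    ENNReal.toReal_ofReal (mul_pos (hvA_pos _) (hvS_pos _)).le] at hreal
  have hset : (IA ∩ IS) ∩ {ω | ∃ t ∈ T, d ≤ t ∧ b < cumul (A · ω) d t - cumul (S · ω) 0 t} =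
      ⋃ n, B n := by
    ext ω
    simp only [Set.mem_inter_iff, Set.mem_iUnion, hB]
    constructor
    · rintro ⟨hω, t, ht, hdt, hlt⟩
      obtain ⟨n, rfl⟩ := Nat.exists_eq_add_of_le hdt
      exact ⟨n, ht, hω, hlt⟩
    · rintro ⟨n, ht, hω, hlt⟩
      exact ⟨hω, d + n, ht, Nat.le_add_right d n, hlt⟩
  have hImΩ : MeasurableSet (IA ∩ IS) := (hXA.le 0 _ hIAm).inter (hXS.le 0 _ hISm)
  rw [hI, measureReal_def, cond_apply hImΩ, hset, ENNReal.toReal_mul, ENNReal.toReal_inv]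
  -- If the conditioning event is null, the conditional probability is zero and the bound is
  -- trivial.
  rcases (ENNReal.toReal_nonneg (a := μ (IA ∩ IS))).eq_or_lt with h0 | hpos
  · rw [← h0, inv_zero, zero_mul]
    have := hvA_pos iA
    have := hvS_pos iS
    positivity
  · rw [inv_mul_le_iff₀ hpos, Real.exp_neg]
    have hden : 0 < hvA kA * hvS kS * Real.exp c := by positivity
    calc (μ (⋃ n, B n)).toReal
        ≤ hvA iA * hvS iS * (μ (IA ∩ IS)).toReal / (hvA kA * hvS kS * Real.exp c) := by
          rw [le_div_iff₀ hden]
          linarith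
      _ = _ := by field_simp

end Bound

end MarkovAdditive

namespace MarkovAdditive

/-! ### Finite-time bounds for delay and backlog -/

section Bound

variable {Ω E E' : Type*} [MeasurableSpace Ω]
  [Fintype E] [DecidableEq E] [MeasurableSpace E] [MeasurableSingletonClass E]
  [Fintype E'] [DecidableEq E'] [MeasurableSpace E'] [MeasurableSingletonClass E']
  {μ : Measure Ω} [IsProbabilityMeasure μ] {FA : E → E → Measure ℝ} {FS : E' → E' → Measure ℝ}
  [∀ i j, IsFiniteMeasure (FA i j)] [∀ i j, IsFiniteMeasure (FS i j)]
  {JA : ℕ → Ω → E} {A : ℕ → Ω → ℝ} {JS : ℕ → Ω → E'} {S : ℕ → Ω → ℝ}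

theorem cond_real_exists_lt_le_of_isPerronVector (hA : IsProcess μ FA JA A)
    (hS : IsProcess μ FS JS S)
    (hindep : IndepFun (fun ω t => (JA t ω, A t ω)) (fun ω t => (JS t ω, S t ω)) μ)
    {θ : ℝ} (hθ : 0 ≤ θ) (hdomA : θ ∈ expDomain FA) (hdomS : θ ∈ expDomain (negKernel FS))
    {hvA : E → ℝ} {hvS : E' → ℝ} (hvA_perron : IsPerronVector FA θ hvA)
    (hvS_perron : IsPerronVector (negKernel FS) θ hvS) (d : ℕ) (iA : E) (iS : E') {T : Set ℕ}
    {b c : ℝ} (hc : ∀ t ∈ T, d ≤ t →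
      c ≤ θ * b + d * kappa FA θ - t * (kappa FA θ + kappa (negKernel FS) θ)) :
    (cond μ {ω | JA d ω = iA ∧ JS 0 ω = iS}).real
        {ω | ∃ t ∈ T, d ≤ t ∧ b < cumul (A · ω) d t - cumul (S · ω) 0 t} ≤
      hvA iA * hvS iS / ((⨅ j, hvA j) * ⨅ j, hvS j) * Real.exp (-c) := by
  have hneg : MeasurableEmbedding fun x : ℝ => -x := (Homeomorph.neg ℝ).measurableEmbedding
  refine cond_real_exists_lt_le hA hS hindep hθ hvA_perron.1 hvS_perron.1 hdomA (fun i j => ?_)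
    (fun i => congrFun hvA_perron.2 i) (fun i => ?_) d iA iS hc
  · have := hneg.integrable_map_iff.1 (hdomS i j)
    simpa [Function.comp_def] using this
  · have := congrFun hvS_perron.2 i
    simpa [Matrix.mulVec, dotProduct, expMatrix, negKernel, hneg.integral_map] using this

end Bound

end MarkovAdditive

/-! ### Position of `θ` relative to `γ` and the final bounds -/

theorem mainTheorem4 {Ω E E' : Type*} [MeasurableSpace Ω]
    [Fintype E] [DecidableEq E] [MeasurableSpace E] [MeasurableSingletonClass E]
    [Fintype E'] [DecidableEq E'] [MeasurableSpace E'] [MeasurableSingletonClass E']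
    (μ : Measure Ω) [IsProbabilityMeasure μ]
    -- kernels of the arrival process and of the service process
    (FA : E → E → Measure ℝ) (FS : E' → E' → Measure ℝ)
    (hFA : IsKernel FA) (hFS : IsKernel FS)
    (hirrA : (transitionMatrix FA).IsIrreducible) (hirrS : (transitionMatrix FS).IsIrreducible)
    -- the traffic arriving in a time slot is nonnegative
    (hnonneg : ∀ i j, ∀ᵐ x ∂(FA i j), 0 ≤ x)
    -- the arrival process and the service process, independent of each other
    (JA : ℕ → Ω → E) (A : ℕ → Ω → ℝ) (JS : ℕ → Ω → E') (S : ℕ → Ω → ℝ)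
    (hA : IsProcess μ FA JA A) (hS : IsProcess μ FS JS S)
    (hindep : IndepFun (fun ω t => (JA t ω, A t ω)) (fun ω t => (JS t ω, S t ω)) μ)
    -- the functions `κ^A`, `κ^{-S}` and the positive root `γ` of `κ^A + κ^{-S} = 0`
    (κA κS : ℝ → ℝ) (hκA : κA = kappa FA) (hκS : κS = kappa (negKernel FS))
    (Θ : Set ℝ) (hΘ : Θ = interior (expDomain FA ∩ expDomain (negKernel FS)))
    (γ : ℝ) (hγ : 0 < γ) (hγΘ : γ ∈ Θ) (hγroot : κA γ + κS γ = 0)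
    (hγderiv : 0 < deriv κA γ + deriv κS γ) :
    -- delay
    (∀ y : ℝ, 1 < y → ∀ θ ∈ Θ, y * deriv κS θ = -(y - 1) * deriv κA θ →
      ∀ (hvA : E → ℝ) (hvS : E' → ℝ),
      IsPerronVector FA θ hvA → IsPerronVector (negKernel FS) θ hvS →
      ∀ (d : ℕ) (iA : E) (iS : E'),
      let P := cond μ {ω | JA d ω = iA ∧ JS 0 ω = iS}
      let yγ := deriv κA γ / (deriv κA γ + deriv κS γ)
      let θy := -y * κS θ - (y - 1) * κA θ
      (y < yγ →
        P.real (delayExceedsBy A S d (y * d)) ≤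
          delayConst hvA hvS * hvS iS * Real.exp (-d * θy)) ∧
      (yγ < y →
        P.real (delayExceeds A S d) - P.real (delayExceedsBy A S d (y * d)) ≤
          delayConst hvA hvS * hvS iS * Real.exp (-d * θy))) ∧
    -- backlog
    (∀ y : ℝ, 0 < y → ∀ θ ∈ Θ, y * (deriv κA θ + deriv κS θ) = 1 →
      ∀ (hvA : E → ℝ) (hvS : E' → ℝ),
      IsPerronVector FA θ hvA → IsPerronVector (negKernel FS) θ hvS →
      ∀ (b : ℝ), 0 ≤ b → ∀ (iA : E) (iS : E'),
      let P := cond μ {ω | JA 0 ω = iA ∧ JS 0 ω = iS}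
      let yγ := 1 / (deriv κA γ + deriv κS γ)
      let θy := θ - y * (κA θ + κS θ)
      (y < yγ →
        P.real (backlogExceedsBy A S b (y * b)) ≤
          backlogConst hvA hvS * hvA iA * hvS iS * Real.exp (-b * θy)) ∧
      (yγ < y →
        P.real (backlogExceeds A S b) - P.real (backlogExceedsBy A S b (y * b)) ≤
          backlogConst hvA hvS * hvA iA * hvS iS * Real.exp (-b * θy))) := by
  have hFA_fin := hFA.isFiniteMeasure
  have hFS_fin := hFS.isFiniteMeasure
  have hFS_fin' := hFS.negKernel.isFiniteMeasure
  have hirrS' : (transitionMatrix (negKernel FS)).IsIrreducible := by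
    rwa [transitionMatrix_negKernel]
  have hΘA : Θ ⊆ interior (expDomain FA) := hΘ ▸ interior_mono Set.inter_subset_left
  have hΘS : Θ ⊆ interior (expDomain (negKernel FS)) :=
    hΘ ▸ interior_mono Set.inter_subset_right
  have hΘc : Convex ℝ Θ := hΘ ▸ (convex_expDomain.inter convex_expDomain).interior
  have hmainA : Nonempty E → ConvexOn ℝ Θ κA ∧ (∀ t ∈ Θ, DifferentiableAt ℝ κA t) ∧ κA 0 = 0 ∧
      ∀ t ∈ Θ, 0 ≤ deriv κA t := by
    rintro hne
    subst hκA
    refine ⟨(convexOn_kappa hirrA).subset (hΘA.trans interior_subset) hΘc,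
      fun t ht => differentiableAt_kappa hirrA (hΘA ht), kappa_zero hFA, fun t ht => ?_⟩
    rw [← derivWithin_of_mem_nhds (isOpen_interior.mem_nhds (hΘA ht))]
    exact ((kappa_mono hirrA hnonneg).mono interior_subset).derivWithin_nonneg
  have hmainS : Nonempty E' → ConvexOn ℝ Θ κS ∧ (∀ t ∈ Θ, DifferentiableAt ℝ κS t) ∧ κS 0 = 0 := by
    rintro hne
    subst hκS
    exact ⟨(convexOn_kappa hirrS').subset (hΘS.trans interior_subset) hΘc,
      fun t ht => differentiableAt_kappa hirrS' (hΘS ht), kappa_zero hFS.negKernel⟩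
  have hderiv : ∀ t, DifferentiableAt ℝ κA t → DifferentiableAt ℝ κS t →
      deriv (κA + κS) t = deriv κA t + deriv κS t := fun t h1 h2 => deriv_add h1 h2
  constructor
  · intro y hy θ hθ hroot hvA hvS hPA hPS d iA iS P yγ θy
    obtain ⟨hAc, hAd, hA0, hA'⟩ := hmainA ⟨iA⟩
    obtain ⟨hSc, hSd, hS0⟩ := hmainS ⟨iS⟩
    have hκc : ConvexOn ℝ Θ (κA + κS) := hAc.add hSc
    have hκd : ∀ t ∈ Θ, DifferentiableAt ℝ (κA + κS) t := fun t ht => (hAd t ht).add (hSd t ht)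
    -- The equation for `θ` says that this convex function is critical at `θ`; its derivative at `γ`
    -- is negative or positive according to whether `y < yγ` or `y > yγ`.
    have hgc : ConvexOn ℝ Θ ((y - 1) • κA + y • κS) :=
      (hAc.smul (by linarith)).add (hSc.smul (by linarith))
    have hgd : ∀ t ∈ Θ, HasDerivAt ((y - 1) • κA + y • κS)
        ((y - 1) * deriv κA t + y * deriv κS t) t := fun t ht =>
      ((hAd t ht).hasDerivAt.const_smul (y - 1)).add ((hSd t ht).hasDerivAt.const_smul y)
    have hgθ : deriv ((y - 1) • κA + y • κS) θ = 0 := by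
      rw [(hgd θ hθ).deriv]
      linarith
    -- Replacing `hvA iA` by the maximum makes the delay bound independent of the arrival state at
    -- time `d`.
    have hconst : hvA iA * hvS iS / ((⨅ j, hvA j) * ⨅ j, hvS j) * Real.exp (-(d * θy)) ≤
        delayConst hvA hvS * hvS iS * Real.exp (-d * θy) := by
      have : Nonempty E := ⟨iA⟩
      have : Nonempty E' := ⟨iS⟩
      have hmA : 0 ≤ ⨅ j, hvA j := Real.iInf_nonneg fun j => (hPA.1 j).le
      have hmS : 0 ≤ ⨅ j, hvS j := Real.iInf_nonneg fun j => (hPS.1 j).le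
      have hsup : hvA iA ≤ ⨆ j, hvA j := le_ciSup (Set.finite_range hvA).bddAbove iA
      have hS' := (hPS.1 iS).le
      rw [neg_mul]
      refine mul_le_mul_of_nonneg_right ?_ (Real.exp_pos _).le
      calc hvA iA * hvS iS / ((⨅ j, hvA j) * ⨅ j, hvS j)
          ≤ (⨆ j, hvA j) * hvS iS / ((⨅ j, hvA j) * ⨅ j, hvS j) := by gcongr
        _ = delayConst hvA hvS * hvS iS := by
          rw [delayConst, div_mul_div_comm, mul_one, div_mul_eq_mul_div]
    have hbound : ∀ {T : Set ℕ}, 0 ≤ θ →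
        (∀ t ∈ T, d ≤ t → (t : ℝ) * (κA θ + κS θ) ≤ y * d * (κA θ + κS θ)) →
        P.real {ω | ∃ t ∈ T, d ≤ t ∧ 0 < cumul (A · ω) d t - cumul (S · ω) 0 t} ≤
          delayConst hvA hvS * hvS iS * Real.exp (-d * θy) := by
      intro T hθ0 hT
      refine le_trans (cond_real_exists_lt_le_of_isPerronVector hA hS hindep hθ0
        (interior_subset (hΘA hθ)) (interior_subset (hΘS hθ)) hPA hPS d iA iS
        fun t ht hdt => ?_) hconst
      rw [← hκA, ← hκS]
      have := hT t ht hdt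
      simp only [θy]
      linarith
    constructor
    · intro hlt
      rw [lt_div_iff₀ hγderiv] at hlt
      have hγθ : γ < θ := hgc.lt_of_deriv_lt hγΘ hθ (hgd γ hγΘ).differentiableAt
        (hgd θ hθ).differentiableAt (by rw [hgθ, (hgd γ hγΘ).deriv]; linarith)
      have hκθ : 0 ≤ κA θ + κS θ := hκc.nonneg_of_root_lt hγΘ hθ (hκd γ hγΘ) hγroot
        (by rwa [hderiv γ (hAd γ hγΘ) (hSd γ hγΘ)]) hγθ
      have heq : delayExceedsBy A S d (y * d) = {ω | ∃ t ∈ {t : ℕ | (t : ℝ) ≤ y * d}, d ≤ t ∧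
          0 < cumul (A · ω) d t - cumul (S · ω) 0 t} := by
        ext ω
        exact exists_congr fun t => and_left_comm
      rw [heq]
      exact hbound (hγ.trans hγθ).le fun t ht _ => mul_le_mul_of_nonneg_right ht hκθ
    · intro hlt
      rw [div_lt_iff₀ hγderiv] at hlt
      have hγθ : θ < γ := hgc.lt_of_deriv_lt hθ hγΘ (hgd θ hθ).differentiableAt
        (hgd γ hγΘ).differentiableAt (by rw [hgθ, (hgd γ hγΘ).deriv]; linarith)
      -- The equation for `θ` reads `y κ'(θ) = κA'(θ)`, and the right side is nonnegative because
      -- arrivals are. This is what yields `θ ≥ 0`.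
      have hκ' : 0 ≤ deriv (κA + κS) θ := by
        rw [hderiv θ (hAd θ hθ) (hSd θ hθ)]
        have h1 : y * (deriv κA θ + deriv κS θ) = deriv κA θ := by linarith
        have h2 := hA' θ hθ
        rw [← h1] at h2
        exact nonneg_of_mul_nonneg_right h2 (by linarith)
      obtain ⟨hθ0, hκθ⟩ := hκc.nonneg_and_nonpos_of_lt_root hγΘ hθ (hκd γ hγΘ) (hκd θ hθ) hγ
        (by simp [hA0, hS0]) hγroot (by rwa [hderiv γ (hAd γ hγΘ) (hSd γ hγΘ)]) hγθ hκ'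
      -- The difference of the two probabilities is at most the probability of an exceedance at some
      -- `t > yd`, where `κ(θ) ≤ 0` helps.
      have hsub : delayExceeds A S d ⊆ {ω | ∃ t ∈ {t : ℕ | y * d < (t : ℝ)}, d ≤ t ∧
          0 < cumul (A · ω) d t - cumul (S · ω) 0 t} ∪ delayExceedsBy A S d (y * d) := by
        rintro ω ⟨t, hdt, h⟩
        rcases lt_or_ge (y * d) (t : ℝ) with ht | ht
        · exact Or.inl ⟨t, ht, hdt, h⟩
        · exact Or.inr ⟨t, hdt, ht, h⟩
      rw [sub_le_iff_le_add]
      refine ((measureReal_mono hsub).trans (measureReal_union_le _ _)).trans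
        (add_le_add_left (hbound hθ0 fun t ht _ => ?_) _)
      exact mul_le_mul_of_nonpos_right (le_of_lt ht) hκθ
  · intro y hy θ hθ hroot hvA hvS hPA hPS b hb iA iS P yγ θy
    obtain ⟨hAc, hAd, hA0, -⟩ := hmainA ⟨iA⟩
    obtain ⟨hSc, hSd, hS0⟩ := hmainS ⟨iS⟩
    have hκc : ConvexOn ℝ Θ (κA + κS) := hAc.add hSc
    have hκd : ∀ t ∈ Θ, DifferentiableAt ℝ (κA + κS) t := fun t ht => (hAd t ht).add (hSd t ht)
    have hκ'θ : deriv (κA + κS) θ = 1 / y := by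
      rw [hderiv θ (hAd θ hθ) (hSd θ hθ), eq_div_iff hy.ne', mul_comm, hroot]
    have hκ'γ := hderiv γ (hAd γ hγΘ) (hSd γ hγΘ)
    have hconst : hvA iA * hvS iS / ((⨅ j, hvA j) * ⨅ j, hvS j) * Real.exp (-(b * θy)) =
        backlogConst hvA hvS * hvA iA * hvS iS * Real.exp (-b * θy) := by
      rw [backlogConst, neg_mul, div_mul_div_comm, mul_one]
      ring
    have hbound : ∀ {T : Set ℕ}, 0 ≤ θ →
        (∀ t ∈ T, (t : ℝ) * (κA θ + κS θ) ≤ y * b * (κA θ + κS θ)) →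
        P.real {ω | ∃ t ∈ T, 0 ≤ t ∧ b < cumul (A · ω) 0 t - cumul (S · ω) 0 t} ≤
          backlogConst hvA hvS * hvA iA * hvS iS * Real.exp (-b * θy) := by
      intro T hθ0 hT
      refine le_trans (cond_real_exists_lt_le_of_isPerronVector hA hS hindep hθ0
        (interior_subset (hΘA hθ)) (interior_subset (hΘS hθ)) hPA hPS 0 iA iS
        fun t ht _ => ?_) hconst.le
      rw [← hκA, ← hκS]
      have := hT t ht
      simp only [θy]
      push_cast
      linarith
    constructor
    · intro hlt
      -- For the backlog `κ'(θ) = 1/y` and `κ'(γ) = 1/yγ`, so `κ` itself locates `θ`.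
      have hγθ : γ < θ := hκc.lt_of_deriv_lt hγΘ hθ (hκd γ hγΘ) (hκd θ hθ) (by
        rw [hκ'θ, hκ'γ]
        exact (lt_one_div hy hγderiv).1 hlt)
      have hκθ : 0 ≤ κA θ + κS θ := hκc.nonneg_of_root_lt hγΘ hθ (hκd γ hγΘ) hγroot
        (by rwa [hκ'γ]) hγθ
      have heq : backlogExceedsBy A S b (y * b) = {ω | ∃ t ∈ {t : ℕ | (t : ℝ) ≤ y * b}, 0 ≤ t ∧
          b < cumul (A · ω) 0 t - cumul (S · ω) 0 t} := by
        ext ω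
        exact exists_congr fun t => and_congr_right fun _ =>
          (and_iff_right (Nat.zero_le t)).symm
      rw [heq]
      exact hbound (hγ.trans hγθ).le fun t ht => mul_le_mul_of_nonneg_right ht hκθ
    · intro hlt
      have hγθ : θ < γ := hκc.lt_of_deriv_lt hθ hγΘ (hκd θ hθ) (hκd γ hγΘ) (by
        rw [hκ'θ, hκ'γ]
        exact (one_div_lt hγderiv hy).1 hlt)
      obtain ⟨hθ0, hκθ⟩ := hκc.nonneg_and_nonpos_of_lt_root hγΘ hθ (hκd γ hγΘ) (hκd θ hθ) hγ
        (by simp [hA0, hS0]) hγroot (by rwa [hκ'γ]) hγθ (by rw [hκ'θ]; positivity)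
      have hsub : backlogExceeds A S b ⊆ {ω | ∃ t ∈ {t : ℕ | y * b < (t : ℝ)}, 0 ≤ t ∧
          b < cumul (A · ω) 0 t - cumul (S · ω) 0 t} ∪ backlogExceedsBy A S b (y * b) := by
        rintro ω ⟨t, h⟩
        rcases lt_or_ge (y * b) (t : ℝ) with ht | ht
        · exact Or.inl ⟨t, ht, Nat.zero_le t, h⟩
        · exact Or.inr ⟨t, ht, h⟩
      rw [sub_le_iff_le_add]
      refine ((measureReal_mono hsub).trans (measureReal_union_le _ _)).trans
        (add_le_add_left (hbound hθ0 fun t ht => ?_) _)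
      exact mul_le_mul_of_nonpos_right (le_of_lt ht) hκθ
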